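/- **Setting.** Let $(\Omega,\mathcal F,(\mathcal F_t)_{t=0,\dots,T},P)$ be a filtered probability space with $T\in\mathbb N$, such that $\mathcal F_0$ contains all $P$-null sets of $\mathcal F$. Let $d\ge 1$, and let $\Theta$ be a nonempty closed subset of a separable metric space. For each $\theta\in\Theta$ let $S^\theta=(S^\theta_t)_{t=0,\dots,T}$ be an adapted $\mathbb R^d$-valued process with $S^\theta_0=(1,\dots,1)$ a.s. Assume that whenever $\theta_n\to\theta$ in $\Theta$, there is a subsequence $(\theta_{n_k})$ such that $S^{\theta_{n_k}}_t\to S^\theta_t$ a.s. for every $0\le t\le T$. A strategy $H\in\mathcal A$ is a process $(H_t)_{t=1,\dots,T}$ with $H_t$ an $\mathcal F_{t-1}$-measurable $\mathbb R^d$-valued random variable, and $H\cdot S^\theta_T=\sum_{t=1}^T\langle H_t,S^\theta_t-S^\theta_{t-1}\rangle$. * $NRA$ (no robust arbitrage): for every $H\in\mathcal A$, if $H\cdot S^\theta_T\ge 0$ a.s. for all $\theta\in\Theta$, then $H\cdot S^\theta_T=0$ a.s. for all $\theta\in\Theta$. * $NA(\theta)$ (classical no arbitrage in the model $\theta$): for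 every $H\in\mathcal A$, if $H\cdot S^\theta_T\ge 0$ a.s., then $H\cdot S^\theta_T=0$ a.s. * A contingent claim is a family $\mathbf f=(f^\theta)_{\theta\in\Theta}$ of a.s. nonnegative $\mathcal F_T$-measurable real random variables. It is replicable if there are $x\in\mathbb R$ and $H\in\mathcal A$ (the same for all models) with $x+H\cdot S^\theta_T=f^\theta$ a.s. for all $\theta\in\Theta$. The market is complete if every contingent claim is replicable. * A robust pricing system is an element $\mathbf Q=(Z^\theta_T)_{\theta\in\Theta}$ of the direct sum $\bigoplus_{\theta\in\Theta}L^\infty(\mathcal F_T,P)$, acting by $\mathbf Q(\mathbf f)=\sum_{\theta}E[Z^\theta_Tf^\theta]$, such that: (i) $Z^\theta_T\ge 0$ for all $\theta$, and $E[Z^\theta_T1_A]>0$ for some $\theta\in\Theta$, $A\in\mathcal F_T$; (ii) $\mathbf Q(\mathbf 1)=1$; (iii) $(S^\theta)_{\theta}$ is a generalized martingale under $\mathbf Q$, that is, $Z^\theta_TS^\theta_t$ is $P$-integrable for all $\theta$ and $t$, $E\big[\big|\sum_\theta E[Z^\theta_T|\mathcal F_t]\,S^\theta_t\big|\big]<\infty$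 for all $t$, and $\sum_\theta E[Z^\theta_TS^\theta_t1_A]=\sum_\theta E[Z^\theta_TS^\theta_s1_A]$ for all $0\le s\le t\le T$ and $A\in\mathcal F_s$. Let $\mathcal Q$ be the set of all robust pricing systems. **Theorem.** Assume $NRA$. Then: 1. The market is complete if and only if $|\mathcal Q|=1$. 2. If the market is complete, then $\Theta$ is finite. 3. If the market is complete and $NA(\theta)$ holds for some $\theta\in\Theta$, then $\Theta=\{\theta\}$. -/

import Mathlib

open MeasureTheory Filter Topology

namespace RobustMarket

noncomputable section

variable {Ω ι : Type*} {mΩ : MeasurableSpace Ω} {d : ℕ}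

/-- A trading strategy over the dates `1, …, T`: an `ℝ^d`-valued predictable process, that is, the
position `H_{t+1}` held over the period from `t` to `t + 1` is `𝓕_t`-measurable. -/
def IsStrategy (F : Filtration ℕ mΩ) (T : ℕ) (H : ℕ → Ω → EuclideanSpace ℝ (Fin d)) : Prop :=
  ∀ t < T, Measurable[F t] (H (t + 1))

/-- The gains `(H · Y)_t = ∑_{s = 1}^t ⟨H_s, Y_s - Y_{s-1}⟩` from trading in the asset `Y`. -/
def gains (H Y : ℕ → Ω → EuclideanSpace ℝ (Fin d)) (t : ℕ) (ω : Ω) : ℝ :=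
  ∑ s ∈ Finset.range t, inner ℝ (H (s + 1) ω) (Y (s + 1) ω - Y s ω)

/-- The classical no-arbitrage condition for a single price process `Y`. -/
def NoArbitrage (P : Measure Ω) (F : Filtration ℕ mΩ) (T : ℕ)
    (Y : ℕ → Ω → EuclideanSpace ℝ (Fin d)) : Prop :=
  ∀ H : ℕ → Ω → EuclideanSpace ℝ (Fin d), IsStrategy F T H →
    (∀ᵐ ω ∂P, 0 ≤ gains H Y T ω) → ∀ᵐ ω ∂P, gains H Y T ω = 0

/-- No robust arbitrage (NRA) for the family of price processes `(S^θ)_θ`: one and the same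
strategy is used in all models. -/
def NoRobustArbitrage (P : Measure Ω) (F : Filtration ℕ mΩ) (T : ℕ)
    (S : ι → ℕ → Ω → EuclideanSpace ℝ (Fin d)) : Prop :=
  ∀ H : ℕ → Ω → EuclideanSpace ℝ (Fin d), IsStrategy F T H →
    (∀ θ, ∀ᵐ ω ∂P, 0 ≤ gains H (S θ) T ω) → ∀ θ, ∀ᵐ ω ∂P, gains H (S θ) T ω = 0

/-- A contingent claim: a family `(f^θ)_θ` of almost surely nonnegative `𝓕_T`-measurable random
variables. -/
def IsContingentClaim (P : Measure Ω) (F : Filtration ℕ mΩ) (T : ℕ) (f : ι → Ω → ℝ) : Prop :=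
  ∀ θ, Measurable[F T] (f θ) ∧ ∀ᵐ ω ∂P, 0 ≤ f θ ω

/-- The family `(f^θ)_θ` is replicable: one initial capital and one strategy yield `f^θ` in every
model `θ`. -/
def IsReplicable (P : Measure Ω) (F : Filtration ℕ mΩ) (T : ℕ)
    (S : ι → ℕ → Ω → EuclideanSpace ℝ (Fin d)) (f : ι → Ω → ℝ) : Prop :=
  ∃ (x : ℝ) (H : ℕ → Ω → EuclideanSpace ℝ (Fin d)), IsStrategy F T H ∧
    ∀ θ, ∀ᵐ ω ∂P, x + gains H (S θ) T ω = f θ ω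

/-- The market is complete: every contingent claim is replicable. -/
def IsComplete (P : Measure Ω) (F : Filtration ℕ mΩ) (T : ℕ)
    (S : ι → ℕ → Ω → EuclideanSpace ℝ (Fin d)) : Prop :=
  ∀ f : ι → Ω → ℝ, IsContingentClaim P F T f → IsReplicable P F T S f

/-- The direct sum `⨁_θ L^∞(𝓕_T, P)`: families of classes of essentially bounded
`𝓕_T`-measurable functions, all but finitely many of them zero. It is the dual of the product
space `∏_θ L^1(𝓕_T, P)`. -/
abbrev DualSpace (ι : Type*) (P : Measure Ω) (F : Filtration ℕ mΩ) (T : ℕ) : Type _ :=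
  ι →₀ lpMeas ℝ ℝ (F T) ⊤ P

/-- A representative of the component `Z^θ_T` of `Z = (Z^θ_T)_θ`. -/
def density {P : Measure Ω} {F : Filtration ℕ mΩ} {T : ℕ} (Z : DualSpace ι P F T) (θ : ι) :
    Ω → ℝ :=
  ((Z θ : Lp ℝ ⊤ P) : Ω → ℝ)

/-- The functional `Q(f) = ∑_θ E[Z^θ_T f^θ]` given by `Z`; it is used for real-valued and for
`ℝ^d`-valued families `f`. -/
def pricing {P : Measure Ω} {F : Filtration ℕ mΩ} {T : ℕ} {E : Type*} [NormedAddCommGroup E]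
    [NormedSpace ℝ E] (Z : DualSpace ι P F T) (f : ι → Ω → E) : E :=
  ∑ θ ∈ Z.support, ∫ ω, density Z θ ω • f θ ω ∂P

/-- The family of processes `(M^θ)_θ` is a generalized martingale under the functional given by
`Z`. The field `integrable_density` says that `Q(1_A M_t)` is meaningful; the field `integrable`
is about the conditional densities `Z^θ_t = E[Z^θ_T | 𝓕_t]`. -/
structure IsGeneralizedMartingale {P : Measure Ω} {F : Filtration ℕ mΩ} {T : ℕ}
    (Z : DualSpace ι P F T) (M : ι → ℕ → Ω → EuclideanSpace ℝ (Fin d)) : Prop where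
  adapted : ∀ θ, ∀ t ≤ T, Measurable[F t] (M θ t)
  integrable_density : ∀ θ, ∀ t ≤ T, Integrable (fun ω => density Z θ ω • M θ t ω) P
  integrable : ∀ t ≤ T,
    Integrable (fun ω => ∑ θ ∈ Z.support, (P[density Z θ | F t]) ω • M θ t ω) P
  pricing_eq : ∀ s t, s ≤ t → t ≤ T → ∀ A : Set Ω, MeasurableSet[F s] A →
    pricing Z (fun θ => A.indicator (M θ t)) = pricing Z (fun θ => A.indicator (M θ s))

/-- `Z = (Z^θ_T)_θ` is a robust pricing system for the family of price processes `(S^θ)_θ`. -/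
structure IsRobustPricingSystem {P : Measure Ω} {F : Filtration ℕ mΩ} {T : ℕ}
    (S : ι → ℕ → Ω → EuclideanSpace ℝ (Fin d)) (Z : DualSpace ι P F T) : Prop where
  nonneg : ∀ θ, ∀ᵐ ω ∂P, 0 ≤ density Z θ ω
  pos : ∃ θ, ∃ A : Set Ω, MeasurableSet[F T] A ∧ 0 < ∫ ω in A, density Z θ ω ∂P
  pricing_one : pricing Z (fun _ _ => (1 : ℝ)) = 1
  martingale : IsGeneralizedMartingale Z S

/-- The set `𝒬^θ` of the robust pricing systems with `Z^θ_T ≠ 0`. -/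
def pricingSystemsAt (P : Measure Ω) (F : Filtration ℕ mΩ) (T : ℕ)
    (S : ι → ℕ → Ω → EuclideanSpace ℝ (Fin d)) (θ : ι) : Set (DualSpace ι P F T) :=
  {Z | IsRobustPricingSystem S Z ∧ Z θ ≠ 0}

/-- The set `𝒬 = ⋃_θ 𝒬^θ` of all robust pricing systems. -/
def pricingSystems (P : Measure Ω) (F : Filtration ℕ mΩ) (T : ℕ)
    (S : ι → ℕ → Ω → EuclideanSpace ℝ (Fin d)) : Set (DualSpace ι P F T) :=
  ⋃ θ, pricingSystemsAt P F T S θ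

end

end RobustMarket

/-! Everything rests on one existence statement: under NRA, each non-null event in each model is
charged by some robust pricing system (`exists_isRobustPricingSystem_of_noArbitrage`). Nonnegative
gains on a countable dense set of models are nonnegative in all models by continuity, so NRA holds
on a countable set of models containing the given one. There the superreplicable families are closed
under almost sure convergence (`exists_portfolio_of_tendsto`), and Hahn-Banach in finite products of
`L^1` separates the indicator of the event, placed in its model, from them. The separating
functional, normalised, is the pricing system.

Completeness gives uniqueness: a replicable nonnegative claim has its replication cost as price
under every pricing system, because in discrete time a martingale transform bounded below is a true
martingale (`integral_add_sum_mul_eq`). The claims "1 on `A` in model `θ`, 0 in the others" then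
determine all densities. The unique system must charge every event in every model, so all its
densities are strictly positive. As an element of a direct sum it has finite support, so `Θ` is
finite. If some `θ' ≠ θ` existed, replicating "1 in `θ'`, 0 elsewhere" would cost some `x > 0`, and
the opposite strategy would earn `x` surely in `θ`, against NA(`θ`).

Conversely, let `Z` be the only pricing system; it is positive in all models. Were an integrable
claim not replicable, a separating `Y` would annihilate constants and gains, and `(1 + εY)Z` would
be a second pricing system (`exists_portfolio_of_unique`). General claims are limits of bounded
ones, and the closedness lemma applies again. -/

namespace RobustMarket

/-! ### Measurable random subsequences and the compactified real line -/

/-- A bounded sequence of measurable functions converges along measurable random indices. -/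
theorem exists_measurable_subsequence {Ω : Type*} {m : MeasurableSpace Ω} {u : ℕ → Ω → ℝ}
    (hu : ∀ n, Measurable (u n)) (hb : ∀ n ω, |u n ω| ≤ 1) :
    ∃ (c : Ω → ℝ) (σ : ℕ → Ω → ℕ), Measurable c ∧ (∀ k, Measurable (σ k)) ∧
      ∀ ω, Tendsto (fun k => σ k ω) atTop atTop ∧
        Tendsto (fun k => u (σ k ω) ω) atTop (𝓝 (c ω)) := by
  classical
  set c : Ω → ℝ := fun ω => limsup (fun n => u n ω) atTop with hc
  have hcm : Measurable c := Measurable.limsup hu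
  have hbdd : ∀ ω, IsBoundedUnder (· ≤ ·) atTop (fun n => u n ω) := fun ω =>
    ⟨1, eventually_map.2 (Eventually.of_forall fun n => (abs_le.1 (hb n ω)).2)⟩
  have hcob : ∀ ω, IsCoboundedUnder (· ≤ ·) atTop (fun n => u n ω) := fun ω =>
    IsBoundedUnder.isCoboundedUnder_flip
      ⟨-1, eventually_map.2 (Eventually.of_forall fun n => (abs_le.1 (hb n ω)).1)⟩
  -- The limsup is a cluster point. Taking the least index beyond `k` that is within `1 / (k + 1)`
  -- of it makes the choice measurable.
  have hex : ∀ (k : ℕ) ω, ∃ n, k ≤ n ∧ |u n ω - c ω| < 1 / ((k : ℝ) + 1) := by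
    intro k ω
    have hε : (0 : ℝ) < 1 / ((k : ℝ) + 1) := by positivity
    have h1 : ∀ᶠ n in atTop, u n ω < c ω + 1 / ((k : ℝ) + 1) :=
      eventually_lt_of_limsup_lt (lt_add_of_pos_right _ hε) (hbdd ω)
    have h2 : ∃ᶠ n in atTop, c ω - 1 / ((k : ℝ) + 1) < u n ω :=
      frequently_lt_of_lt_limsup (hcob ω) (sub_lt_self _ hε)
    obtain ⟨n, hn2, hn1, hnk⟩ := (h2.and_eventually (h1.and (eventually_ge_atTop k))).exists
    exact ⟨n, hnk, abs_lt.2 ⟨by linarith, by linarith⟩⟩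
  refine ⟨c, fun k ω => Nat.find (hex k ω), hcm, fun k => ?_, fun ω => ⟨?_, ?_⟩⟩
  · refine measurable_find (hex k) fun n => ?_
    by_cases hkn : k ≤ n
    · simp only [hkn, true_and]
      exact measurableSet_lt ((hu n).sub hcm).abs measurable_const
    · simp [hkn]
  · exact tendsto_atTop_mono (fun k => (Nat.find_spec (hex k ω)).1) tendsto_id
  · rw [tendsto_iff_dist_tendsto_zero]
    refine squeeze_zero (fun _ => dist_nonneg) (fun k => ?_)
      tendsto_one_div_add_atTop_nhds_zero_nat
    exact (Nat.find_spec (hex k ω)).2.le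

theorem measurable_randomIndex {Ω : Type*} {m : MeasurableSpace Ω} {f : ℕ → Ω → ℝ}
    {σ : Ω → ℕ} (hf : ∀ n, Measurable (f n)) (hσ : Measurable σ) :
    Measurable fun ω => f (σ ω) ω := by
  have : Measurable fun p : ℕ × Ω => f p.1 p.2 := measurable_from_prod_countable_right hf
  exact this.comp (hσ.prodMk measurable_id)

/-- The map `x ↦ x / (1 + |x|)` identifies the real line with `(-1, 1)`. -/
theorem tendsto_of_tendsto_div_one_add_abs {x : ℕ → ℝ} {c : ℝ}
    (h : Tendsto (fun n => x n / (1 + |x n|)) atTop (𝓝 c)) (hc : |c| < 1) :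
    Tendsto x atTop (𝓝 (c / (1 - |c|))) := by
  have h2 : Tendsto (fun n => (x n / (1 + |x n|)) / (1 - |x n / (1 + |x n|)|)) atTop
      (𝓝 (c / (1 - |c|))) := h.div (tendsto_const_nhds.sub h.abs) (by linarith)
  refine h2.congr fun n => ?_
  have hp : 0 < 1 + |x n| := by positivity
  rw [abs_div, abs_of_pos hp]
  have : 1 - |x n| / (1 + |x n|) = 1 / (1 + |x n|) := by field_simp; ring
  rw [this]
  field_simp

/-- The endpoints `±1` of the compactification are `±∞`: here `c` is the sign with which the
sequence diverges. -/
theorem tendsto_atTop_of_tendsto_div_one_add_abs {x : ℕ → ℝ} {c : ℝ}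
    (h : Tendsto (fun n => x n / (1 + |x n|)) atTop (𝓝 c)) (hc : |c| = 1) :
    Tendsto (fun n => c * x n) atTop atTop := by
  have hcc : c * c = 1 := by rw [← abs_mul_abs_self, hc, one_mul]
  have h1 : Tendsto (fun n => c * (x n / (1 + |x n|))) atTop (𝓝 1) := by
    simpa [hcc] using h.const_mul c
  rw [tendsto_atTop]
  intro b
  -- Since `y ↦ y / (1 + y)` is increasing on `[0, ∞)`, exceeding the image of `max b 0` forces `c *
  -- x n` beyond `max b 0`.
  have hb : (max b 0) / (1 + max b 0) < 1 := by
    rw [div_lt_one (by positivity)]; linarith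
  filter_upwards [h1.eventually (lt_mem_nhds hb)] with n hn
  have hp : 0 < 1 + |x n| := by positivity
  have hab : |x n| = |c * x n| := by rw [abs_mul, hc, one_mul]
  rw [← mul_div_assoc, hab] at hn
  have hp' : 0 < 1 + |c * x n| := by positivity
  have hm : 0 ≤ max b 0 := le_max_right _ _
  rw [div_lt_div_iff₀ (by positivity) hp'] at hn
  have hpos : 0 < c * x n := by
    by_contra hneg
    have h3 : 0 ≤ max b 0 * (1 + |c * x n|) := by positivity
    have h4 : c * x n * (1 + max b 0) ≤ 0 :=
      mul_nonpos_of_nonpos_of_nonneg (not_lt.1 hneg) (by positivity)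
    linarith
  rw [abs_of_pos hpos] at hn
  have : max b 0 < c * x n := by nlinarith
  exact (le_max_left b 0).trans this.le

/-! ### Closedness of attainable families under almost sure convergence -/

/-- The sequence `a, u 0, u 1, …`. -/
def seqCons {α : Type*} (a : α) (u : ℕ → α) : ℕ → α
  | 0 => a
  | n + 1 => u n

/-- The set of the families `g` that are, up to an error in the closed convex cone `ρ ⊆ ℝ`,
attained by portfolios `∑ j < N, h j * X j` with `m j`-measurable `h j`, is closed under almost sure
convergence if the only attainable families with values in `ρ` vanish. -/
theorem exists_portfolio_of_tendsto {ι Ω : Type*} {mΩ : MeasurableSpace Ω} (P : Measure Ω)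
    (I : Set ι) {ρ : Set ℝ} (hρ : IsClosed ρ)     (hmul : ∀ a : ℝ, 0 ≤ a → ∀ x ∈ ρ, a * x ∈ ρ) (N : ℕ) :
    ∀ (m : ℕ → MeasurableSpace Ω) (_ : Monotone m) (X : ℕ → ι → Ω → ℝ)
      (_ : ∀ h : ℕ → Ω → ℝ, (∀ j, Measurable[m j] (h j)) →
        (∀ θ ∈ I, ∀ᵐ ω ∂P, ∑ j ∈ Finset.range N, h j ω * X j θ ω ∈ ρ) →
        ∀ θ ∈ I, ∀ᵐ ω ∂P, ∑ j ∈ Finset.range N, h j ω * X j θ ω = 0)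
      (h : ℕ → ℕ → Ω → ℝ) (r : ℕ → ι → Ω → ℝ) (g : ι → Ω → ℝ),
      (∀ n j, Measurable[m j] (h n j)) → (∀ θ ∈ I, ∀ᵐ ω ∂P, ∀ n, r n θ ω ∈ ρ) →
      (∀ θ ∈ I, ∀ᵐ ω ∂P,
        Tendsto (fun n => ∑ j ∈ Finset.range N, h n j ω * X j θ ω - r n θ ω) atTop
          (𝓝 (g θ ω))) →
      ∃ h' : ℕ → Ω → ℝ, (∀ j, Measurable[m j] (h' j)) ∧
        ∀ θ ∈ I, ∀ᵐ ω ∂P, ∑ j ∈ Finset.range N, h' j ω * X j θ ω - g θ ω ∈ ρ := by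
  induction N with
  | zero =>
    intro m _ X _ h r g _ hr hlim
    refine ⟨fun _ _ => 0, fun _ => measurable_const, fun θ hθ => ?_⟩
    filter_upwards [hr θ hθ, hlim θ hθ] with ω h1 h2
    simp only [Finset.range_zero, Finset.sum_empty, zero_sub] at h2 ⊢
    have h3 : Tendsto (fun n => r n θ ω) atTop (𝓝 (-g θ ω)) := by simpa using h2.neg
    exact hρ.mem_of_tendsto h3 (Eventually.of_forall h1)
  | succ N ih =>
    intro m hm X hNA h r g hh hr hlim
    have hmj : ∀ j, m 0 ≤ m (j + 1) := fun j => hm (Nat.zero_le _)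
    have hm' : Monotone fun j => m (j + 1) := fun a b hab => hm (by omega)
    have hm0 : ∀ n, Measurable[m 0] (h n 0) := fun n => hh n 0
    -- The random indices are `m 0`-measurable, hence admissible for every later component. They
    -- depend on the first position only and not on `θ`, so one subsequence serves all models at
    -- once.
    obtain ⟨c, σ, hc, hσ, hcσ⟩ := @exists_measurable_subsequence Ω (m 0)
      (fun n ω => h n 0 ω / (1 + |h n 0 ω|))
      (fun n => (hm0 n).div (measurable_const.add (measurable_norm.comp (hm0 n)))) (fun n ω => by
        have hp : 0 < 1 + |h n 0 ω| := by positivity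
        rw [abs_div, abs_of_pos hp, div_le_one hp]; linarith)
    -- the sequence along the random indices
    set k : ℕ → ℕ → Ω → ℝ := fun n j ω => h (σ n ω) j ω with hk
    have hkm : ∀ n j, Measurable[m j] (k n j) := fun n j =>
      @measurable_randomIndex Ω (m j) _ _ (fun i => hh i j) ((hσ n).mono (hm (Nat.zero_le j)) le_rfl)
    set q : ℕ → ι → Ω → ℝ := fun n θ ω => r (σ n ω) θ ω with hq
    have hq' : ∀ θ ∈ I, ∀ᵐ ω ∂P, ∀ n, q n θ ω ∈ ρ := fun θ hθ => by
      filter_upwards [hr θ hθ] with ω h1 n using h1 _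
    have hklim : ∀ θ ∈ I, ∀ᵐ ω ∂P, Tendsto (fun n => k n 0 ω * X 0 θ ω +
        ∑ j ∈ Finset.range N, k n (j + 1) ω * X (j + 1) θ ω - q n θ ω) atTop (𝓝 (g θ ω)) := by
      intro θ hθ
      filter_upwards [hlim θ hθ] with ω h1
      refine (h1.comp (hcσ ω).1).congr fun n => ?_
      simp only [Function.comp, Finset.sum_range_succ', hk, hq]
      ring
    have hclim : ∀ ω, Tendsto (fun n => k n 0 ω / (1 + |k n 0 ω|)) atTop (𝓝 (c ω)) :=
      fun ω => (hcσ ω).2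
    have hc1 : ∀ ω, |c ω| ≤ 1 := fun ω => by
      refine le_of_tendsto (hclim ω).abs (Eventually.of_forall fun n => ?_)
      have hp : 0 < 1 + |k n 0 ω| := by positivity
      rw [abs_div, abs_of_pos hp, div_le_one hp]; linarith
    have hAm : MeasurableSet[m 0] {ω | |c ω| = 1} :=
      (measurable_norm.comp hc) (measurableSet_singleton (1 : ℝ))
    classical
    -- `s` is the sign of the first component where that component diverges
    set s : Ω → ℝ := fun ω => if |c ω| = 1 then c ω else 0 with hs
    have hsm : Measurable[m 0] s := Measurable.ite hAm hc measurable_const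
    have hs0 : ∀ ω, |c ω| ≠ 1 → s ω = 0 := fun ω h => by simp [hs, h]
    have hs1 : ∀ ω, |c ω| = 1 → s ω = c ω ∧ s ω * s ω = 1 := fun ω h => by
      simp only [hs, h, if_true, true_and]
      rw [← abs_mul_abs_self, h, one_mul]
    -- Where the first component diverges, `v` is eventually the inverse of its absolute value; the
    -- maximum with `1` only tames early terms. Scaling by `v` sends the first component to its sign
    -- and the total value to `0`.
    set v : ℕ → Ω → ℝ := fun n ω => if |c ω| = 1 then (max (c ω * k n 0 ω) 1)⁻¹ else 0 with hv
    have hvm : ∀ n, Measurable[m 0] (v n) := fun n =>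
      Measurable.ite hAm ((hc.mul (hkm n 0)).max measurable_const).inv measurable_const
    have hv0 : ∀ n ω, 0 ≤ v n ω := fun n ω => by
      simp only [hv]; split_ifs <;> positivity
    have hvlim : ∀ ω, Tendsto (fun n => v n ω) atTop (𝓝 0) := by
      intro ω
      by_cases h1 : |c ω| = 1
      · simp only [hv, h1, if_true]
        refine tendsto_inv_atTop_zero.comp (tendsto_atTop_mono (fun n => le_max_left _ _)
          (tendsto_atTop_of_tendsto_div_one_add_abs (hclim ω) h1))
      · simp [hv, h1]
    have hvk : ∀ ω, Tendsto (fun n => v n ω * k n 0 ω) atTop (𝓝 (s ω)) := by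
      intro ω
      by_cases h1 : |c ω| = 1
      · refine tendsto_const_nhds.congr' ?_
        filter_upwards [(tendsto_atTop_of_tendsto_div_one_add_abs (hclim ω) h1).eventually
          (eventually_ge_atTop 1)] with n hn
        have hne : c ω * k n 0 ω ≠ 0 := by positivity
        have hcc := (hs1 ω h1).2
        rw [(hs1 ω h1).1] at hcc ⊢
        simp only [hv, h1, if_true, max_eq_left hn]
        rw [inv_mul_eq_div, eq_div_iff hne, ← mul_assoc, hcc, one_mul]
      · simp [hv, h1, hs]
    -- After scaling, the remaining components less errors tend to `-s X 0`. The induction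
    -- hypothesis turns this limit into a portfolio `(s, p)` with values in `ρ`.
    obtain ⟨p, hpm, hp⟩ := ih (fun j => m (j + 1)) hm' (fun j => X (j + 1))
      (fun h' hh' hpos => by
        have := hNA (seqCons (fun _ => 0) h')
          (fun j => by cases j with
            | zero => exact measurable_const
            | succ j => exact hh' j)
          (fun θ hθ => by simpa [Finset.sum_range_succ', seqCons] using hpos θ hθ)
        intro θ hθ
        simpa [Finset.sum_range_succ', seqCons] using this θ hθ)
      (fun n j ω => v n ω * k n (j + 1) ω) (fun n θ ω => v n ω * q n θ ω)
      (fun θ ω => - (s ω * X 0 θ ω))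
      (fun n j => ((hvm n).mono (hmj j) le_rfl).mul (hkm n (j + 1)))
      (fun θ hθ => by
        filter_upwards [hq' θ hθ] with ω h1 n using hmul _ (hv0 n ω) _ (h1 n))
      (fun θ hθ => by
        filter_upwards [hklim θ hθ] with ω h1
        have h2 := ((hvlim ω).mul h1).sub ((hvk ω).mul_const (X 0 θ ω))
        rw [zero_mul, zero_sub] at h2
        refine h2.congr fun n => ?_
        simp only [mul_assoc, ← Finset.mul_sum]
        ring)
    -- Absence of arbitrage makes the value of `(s, p)` vanish: where the first component diverges,
    -- the first asset is redundant.
    have hpe : ∀ θ ∈ I, ∀ᵐ ω ∂P,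
        s ω * X 0 θ ω = - ∑ j ∈ Finset.range N, p j ω * X (j + 1) θ ω := by
      have := hNA (seqCons s p)
          (fun j => by cases j with
            | zero => exact hsm
            | succ j => exact hpm j)
          (fun θ hθ => by
            filter_upwards [hp θ hθ] with ω h1
            simpa [Finset.sum_range_succ', seqCons] using h1)
      intro θ hθ
      filter_upwards [this θ hθ] with ω h1
      rw [Finset.sum_range_succ'] at h1
      simp only [seqCons] at h1
      linarith
    set z : Ω → ℝ := fun ω => if |c ω| = 1 then 0 else c ω / (1 - |c ω|) with hz
    have hzm : Measurable[m 0] z :=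
      Measurable.ite hAm measurable_const (hc.div (measurable_const.sub (measurable_norm.comp hc)))
    -- Gaussian elimination: subtracting `k n 0 * s` times the worthless portfolio `(s, p)` removes
    -- the first component where `s * s = 1`. Elsewhere `s = 0` and the first component converges to
    -- `z`. In both cases only the later components are left to control.
    obtain ⟨y, hym, hy⟩ := ih (fun j => m (j + 1)) hm' (fun j => X (j + 1))
      (fun h' hh' hpos => by
        have := hNA (seqCons (fun _ => 0) h')
          (fun j => by cases j with
            | zero => exact measurable_const
            | succ j => exact hh' j)
          (fun θ hθ => by simpa [Finset.sum_range_succ', seqCons] using hpos θ hθ)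
        intro θ hθ
        simpa [Finset.sum_range_succ', seqCons] using this θ hθ)
      (fun n j ω => k n (j + 1) ω - k n 0 ω * s ω * p j ω) q
      (fun θ ω => g θ ω - z ω * X 0 θ ω)
      (fun n j => (hkm n (j + 1)).sub ((((hkm n 0).mul hsm).mono (hmj j) le_rfl).mul (hpm j))) hq'
      (fun θ hθ => by
        filter_upwards [hklim θ hθ, hpe θ hθ] with ω h1 h2
        have h3 : ∀ n, ∑ j ∈ Finset.range N,
            (k n (j + 1) ω - k n 0 ω * s ω * p j ω) * X (j + 1) θ ω =
            ∑ j ∈ Finset.range N, k n (j + 1) ω * X (j + 1) θ ω +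
              k n 0 ω * s ω * (s ω * X 0 θ ω) := by
          intro n
          rw [h2, mul_neg, Finset.mul_sum, ← sub_eq_add_neg, ← Finset.sum_sub_distrib]
          refine Finset.sum_congr rfl fun j _ => by ring
        simp only [h3]
        by_cases h4 : |c ω| = 1
        · simp only [hz, h4, if_true, zero_mul, sub_zero]
          refine h1.congr fun n => ?_
          have := (hs1 ω h4).2
          linear_combination (-k n 0 ω * X 0 θ ω) * this
        · have h5 := tendsto_of_tendsto_div_one_add_abs (hclim ω) (lt_of_le_of_ne (hc1 ω) h4)
          simp only [hz, h4, if_false, hs0 ω h4]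
          refine (h1.sub (h5.mul_const (X 0 θ ω))).congr fun n => ?_
          ring)
    refine ⟨seqCons z y, fun j => by
      cases j with
      | zero => exact hzm
      | succ j => exact hym j, fun θ hθ => ?_⟩
    filter_upwards [hy θ hθ] with ω h1
    rw [Finset.sum_range_succ']
    simp only [seqCons]
    convert h1 using 1
    ring

/-! ### Duality of `L^1` and `L^∞`, and separation in finite products -/

theorem norm_apply_toL1_le {Ω : Type*} {mΩ : MeasurableSpace Ω} {P : Measure Ω}
    (Λ : StrongDual ℝ (Lp ℝ 1 P)) {f : Ω → ℝ} (hf : Integrable f P) :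
    |Λ (hf.toL1 f)| ≤ ‖Λ‖ * ∫ ω, |f ω| ∂P := by
  have := Λ.le_opNorm (hf.toL1 f)
  rwa [L1.norm_of_fun_eq_integral_norm] at this

theorem apply_toL1_eq_zero {Ω : Type*} {mΩ : MeasurableSpace Ω} {P : Measure Ω}
    (Λ : StrongDual ℝ (Lp ℝ 1 P)) {f : Ω → ℝ} (hf : Integrable f P) (h0 : f =ᵐ[P] 0) :
    Λ (hf.toL1 f) = 0 := by
  have h1 : ∫ ω, |f ω| ∂P = 0 := by
    rw [integral_congr_ae (g := fun _ => (0 : ℝ)) (by filter_upwards [h0] with ω h; simp [h])]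
    simp
  have := norm_apply_toL1_le Λ hf
  rw [h1, mul_zero] at this
  exact abs_nonpos_iff.1 this

theorem integrable_indicator_one {Ω : Type*} {mΩ : MeasurableSpace Ω} {P : Measure Ω}
    [IsFiniteMeasure P] {A : Set Ω} (hA : MeasurableSet A) :
    Integrable (A.indicator fun _ => (1 : ℝ)) P :=
  (integrable_const 1).indicator hA

/-- The signed measure `A ↦ Λ 1_A` of a continuous linear functional `Λ` on `L^1`. -/
theorem exists_signedMeasure_of_strongDual {Ω : Type*} {mΩ : MeasurableSpace Ω} {P : Measure Ω}
    [IsFiniteMeasure P] (Λ : StrongDual ℝ (Lp ℝ 1 P)) :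
    ∃ s : SignedMeasure Ω, ∀ (A : Set Ω) (hA : MeasurableSet A),
      s A = Λ ((integrable_indicator_one (P := P) hA).toL1 _) := by
  classical
  refine ⟨⟨fun A => if hA : MeasurableSet A then
    Λ ((integrable_indicator_one (P := P) hA).toL1 _) else 0, ?_, ?_, ?_⟩, ?_⟩
  · rw [dif_pos MeasurableSet.empty]
    exact apply_toL1_eq_zero Λ _ (by rw [Set.indicator_empty]; exact EventuallyEq.rfl)
  · intro A hA; simp [hA]
  · intro f hf hd
    have hU : MeasurableSet (⋃ i, f i) := MeasurableSet.iUnion hf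
    simp only [hf, hU, dif_pos]
    have hsum : HasSum (fun i => P.real (f i)) (P.real (⋃ i, f i)) := by
      have h1 := ENNReal.hasSum_toReal (f := fun i => P (f i))
        (by rw [← measure_iUnion hd hf]; exact measure_ne_top _ _)
      have h2 := ENNReal.tsum_toReal_eq (f := fun i => P (f i)) (fun i => measure_ne_top _ _)
      rw [← h2, ← measure_iUnion hd hf] at h1
      exact h1
    suffices HasSum (fun i => (integrable_indicator_one (P := P) (hf i)).toL1 _)
        ((integrable_indicator_one (P := P) hU).toL1 _) from this.mapL Λ
    -- By disjointness, the indicator of the union minus a partial sum is nonnegative, so its `L^1`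
    -- norm is the difference of the probabilities, which tends to `0`.
    rw [HasSum, tendsto_iff_norm_sub_tendsto_zero]
    have h0 : Tendsto (fun t : Finset ℕ => P.real (⋃ i, f i) - ∑ i ∈ t, P.real (f i)) atTop
        (𝓝 0) := by simpa using hsum.const_sub (P.real (⋃ i, f i))
    refine h0.congr fun t => ?_
    have hint : ∀ i, Integrable ((f i).indicator fun _ => (1 : ℝ)) P :=
      fun i => integrable_indicator_one (hf i)
    have hle : ∀ ω, 0 ≤ (⋃ i, f i).indicator (fun _ => (1 : ℝ)) ω -
        ∑ i ∈ t, (f i).indicator (fun _ => (1 : ℝ)) ω := by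
      intro ω
      rw [sub_nonneg, ← Finset.indicator_biUnion_apply t f
        (fun i _ j _ hij => hd hij)]
      exact Set.indicator_le_indicator_of_subset
        (Set.iUnion₂_subset fun i _ => Set.subset_iUnion f i) (fun _ => zero_le_one) ω
    have hs : ∑ i ∈ t, (hint i).toL1 _ =
        (integrable_finsetSum t fun i _ => hint i).toL1
          (fun ω => ∑ i ∈ t, (f i).indicator (fun _ => (1 : ℝ)) ω) := by
      clear hle h0
      induction t using Finset.induction_on with
      | empty => 
        symm
        simp only [Finset.sum_empty]
        exact Integrable.toL1_zero _
      | insert a t ha ih =>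
        rw [Finset.sum_insert ha, ih, ← Integrable.toL1_add]
        congr 1
        ext ω
        simp [Finset.sum_insert ha]
    rw [hs, norm_sub_rev, ← Integrable.toL1_sub, L1.norm_of_fun_eq_integral_norm]
    simp only [Pi.sub_apply, Real.norm_eq_abs, abs_of_nonneg (hle _)]
    rw [integral_sub (integrable_indicator_one hU) (integrable_finsetSum t fun i _ => hint i),
      integral_finsetSum t fun i _ => hint i, integral_indicator_const _ hU]
    simp [integral_indicator_const, hf]
  · intro A hA
    exact dif_pos hA

/-- A continuous linear functional on `L^1` of a finite measure is represented by a bounded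
function. -/
theorem exists_density_of_strongDual {Ω : Type*} {mΩ : MeasurableSpace Ω} {P : Measure Ω}
    [IsFiniteMeasure P] (Λ : StrongDual ℝ (Lp ℝ 1 P)) :
    ∃ Y : Ω → ℝ, Measurable Y ∧ (∀ ω, |Y ω| ≤ ‖Λ‖) ∧
      ∀ f : Lp ℝ 1 P, Λ f = ∫ ω, Y ω * f ω ∂P := by
  obtain ⟨s, hs⟩ := exists_signedMeasure_of_strongDual Λ
  have hac : s ≪ᵥ P.toENNRealVectorMeasure := by
    refine VectorMeasure.AbsolutelyContinuous.mk fun A hA h0 => ?_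
    rw [Measure.toENNRealVectorMeasure_apply_measurable hA] at h0
    rw [hs A hA]
    exact apply_toL1_eq_zero Λ _ (indicator_meas_zero h0)
  set Y₀ := s.rnDeriv P with hY₀
  have hY₀i : Integrable Y₀ P := SignedMeasure.integrable_rnDeriv s P
  have hY₀s : ∀ A, MeasurableSet A → ∫ ω in A, Y₀ ω ∂P = s A := fun A hA => by
    rw [← withDensityᵥ_apply hY₀i hA, SignedMeasure.withDensityᵥ_rnDeriv_eq s P hac]
  -- Bounding `Λ 1_A` by `‖Λ‖ * P A` on all sets bounds the Radon-Nikodym derivative by `‖Λ‖` almost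
  -- everywhere.
  have hb : ∀ A, MeasurableSet A → |∫ ω in A, Y₀ ω ∂P| ≤ ‖Λ‖ * P.real A := fun A hA => by
    rw [hY₀s A hA, hs A hA]
    refine (norm_apply_toL1_le Λ _).trans_eq ?_
    congr 1
    rw [← setIntegral_one_eq_measureReal, ← integral_indicator hA]
    refine integral_congr_ae (Eventually.of_forall fun ω => ?_)
    by_cases h : ω ∈ A <;> simp [h]
  have hup : Y₀ ≤ᵐ[P] fun _ => ‖Λ‖ :=
    ae_le_of_forall_setIntegral_le hY₀i (integrable_const _) fun A hA _ => by
      rw [setIntegral_const, smul_eq_mul, mul_comm]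
      exact (abs_le.1 (hb A hA)).2
  have hlo : (fun _ => -‖Λ‖) ≤ᵐ[P] Y₀ :=
    ae_le_of_forall_setIntegral_le (integrable_const _) hY₀i fun A hA _ => by
      rw [setIntegral_const, smul_eq_mul, mul_neg, mul_comm]
      exact (abs_le.1 (hb A hA)).1
  -- Truncation changes the derivative on a null set only and makes the bound hold everywhere.
  set Y : Ω → ℝ := fun ω => max (min (Y₀ ω) ‖Λ‖) (-‖Λ‖) with hY
  have hYY : Y =ᵐ[P] Y₀ := by
    filter_upwards [hup, hlo] with ω h1 h2
    simp only [hY, min_eq_left h1, max_eq_left h2]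
  have hYm : Measurable Y :=
    ((SignedMeasure.measurable_rnDeriv s P).min measurable_const).max measurable_const
  have hYb : ∀ ω, |Y ω| ≤ ‖Λ‖ := fun ω => by
    have := norm_nonneg Λ
    exact abs_le.2 ⟨le_max_right _ _, max_le (min_le_right _ _) (by linarith)⟩
  have hint : ∀ {f : Ω → ℝ}, Integrable f P → Integrable (fun ω => Y ω * f ω) P := fun hf =>
    hf.bdd_mul hYm.aestronglyMeasurable (Eventually.of_forall hYb)
  refine ⟨Y, hYm, hYb, fun f => ?_⟩
  induction f using Lp.induction ENNReal.one_ne_top with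
  | @indicatorConst c A hA hPA =>
    have hcA : (Lp.simpleFunc.indicatorConst 1 hA hPA.ne c : Lp ℝ 1 P) =
        c • (integrable_indicator_one (P := P) hA).toL1 _ := by
      rw [← Integrable.toL1_smul]
      refine Lp.ext ?_
      rw [Lp.simpleFunc.coe_indicatorConst]
      refine indicatorConstLp_coeFn.trans ((Integrable.coeFn_toL1 _).trans ?_).symm
      refine Eventually.of_forall fun ω => ?_
      by_cases h : ω ∈ A <;> simp [h]
    rw [hcA, map_smul, ← hs A hA, ← hY₀s A hA, smul_eq_mul, ← integral_indicator hA,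
      ← integral_const_mul]
    refine integral_congr_ae ?_
    filter_upwards [hYY, Lp.coeFn_smul c ((integrable_indicator_one (P := P) hA).toL1 _),
      (integrable_indicator_one (P := P) hA).coeFn_toL1] with ω h1 h2 h3
    rw [h2, Pi.smul_apply, h3, h1]
    by_cases h : ω ∈ A <;> simp [h, mul_comm]
  | @add f g hf hg _ h1 h2 =>
    rw [map_add, h1, h2, ← integral_add (hint (L1.integrable_coeFn _))
      (hint (L1.integrable_coeFn _))]
    refine integral_congr_ae ?_
    filter_upwards [Lp.coeFn_add (hf.toLp f) (hg.toLp g)] with ω h3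
    rw [h3, Pi.add_apply, mul_add]
  | isClosed =>
    refine isClosed_eq Λ.continuous ?_
    refine (LipschitzWith.of_dist_le_mul (K := ‖Λ‖₊) fun f g => ?_).continuous
    rw [Real.dist_eq, ← integral_sub (hint (L1.integrable_coeFn f)) (hint (L1.integrable_coeFn g)),
      coe_nnnorm, dist_eq_norm, L1.norm_eq_integral_norm, ← integral_const_mul]
    refine (abs_integral_le_integral_abs).trans (integral_mono_ae ?_ ?_ ?_)
    · exact ((hint (L1.integrable_coeFn f)).sub (hint (L1.integrable_coeFn g))).abs
    · exact (L1.integrable_coeFn (f - g)).norm.const_mul _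
    · filter_upwards [Lp.coeFn_sub f g] with ω h
      rw [h, Pi.sub_apply, ← mul_sub, abs_mul, Real.norm_eq_abs]
      exact mul_le_mul_of_nonneg_right (hYb ω) (abs_nonneg _)

/-- The Hahn–Banach theorem for convex cones in finite products of `L^1`. -/
theorem exists_densities_of_notMem_closure {J Ω : Type*} [Fintype J] {mΩ : MeasurableSpace Ω}
    {P : Measure Ω} [IsFiniteMeasure P] {D : Set (J → Lp ℝ 1 P)} (hconv : Convex ℝ D)
    (h0 : 0 ∈ D) (hcone : ∀ a : ℝ, 0 ≤ a → ∀ g ∈ D, a • g ∈ D) {f : J → Lp ℝ 1 P}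
    (hf : f ∉ closure D) :
    ∃ Y : J → Ω → ℝ, (∀ j, Measurable (Y j)) ∧ (∃ C : ℝ, ∀ j ω, |Y j ω| ≤ C) ∧
      0 < ∑ j, ∫ ω, Y j ω * f j ω ∂P ∧ ∀ g ∈ D, ∑ j, ∫ ω, Y j ω * g j ω ∂P ≤ 0 := by
  classical
  obtain ⟨Λ, u, hD, hu⟩ := geometric_hahn_banach_closed_point hconv.closure isClosed_closure hf
  have hΛD : ∀ g ∈ D, Λ g ≤ 0 := by
    intro g hg
    by_contra! hpos
    -- Scaled by `|u| / Λ g`, the element `g` would have value `|u|`, which is not below `u`.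
    have h1 := hD _ (subset_closure (hcone (|u| / Λ g) (by positivity) g hg))
    rw [map_smul, smul_eq_mul, div_mul_cancel₀ _ hpos.ne'] at h1
    exact absurd (le_abs_self u) (not_le.2 h1)
  have hΛf : 0 < Λ f := by
    have := hD 0 (subset_closure h0)
    rw [map_zero] at this
    exact this.trans hu
  choose Y hYm hYb hY using fun j : J =>
    exists_density_of_strongDual (Λ.comp (ContinuousLinearMap.single ℝ (fun _ => Lp ℝ 1 P) j))
  have hrep : ∀ g, Λ g = ∑ j, ∫ ω, Y j ω * g j ω ∂P := by
    intro g
    conv_lhs => rw [← Finset.univ_sum_single g]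
    rw [map_sum]
    refine Finset.sum_congr rfl fun j _ => ?_
    rw [← hY j]
    rfl
  refine ⟨Y, hYm, ⟨∑ j, ‖Λ.comp (ContinuousLinearMap.single ℝ (fun _ => Lp ℝ 1 P) j)‖,
    fun j ω => (hYb j ω).trans (Finset.single_le_sum
      (f := fun j => ‖Λ.comp (ContinuousLinearMap.single ℝ (fun _ => Lp ℝ 1 P) j)‖)
      (fun _ _ => norm_nonneg _) (Finset.mem_univ j))⟩,
    hrep f ▸ hΛf, fun g hg => hrep g ▸ hΛD g hg⟩

/-! ### Separation over countably many models -/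

/-- Summable `L^1` norms make the sum of the absolute values integrable, hence almost surely finite.
-/
theorem ae_tendsto_zero_of_integral_abs_le {Ω : Type*} {mΩ : MeasurableSpace Ω} {P : Measure Ω}
    {u : ℕ → Ω → ℝ} (hu : ∀ n, Integrable (u n) P)
    (hle : ∀ n, ∫ ω, |u n ω| ∂P ≤ (1 / 2) ^ n) :
    ∀ᵐ ω ∂P, Tendsto (fun n => u n ω) atTop (𝓝 0) := by
  have h1 : ∫⁻ ω, ∑' n, ‖u n ω‖ₑ ∂P ≠ ⊤ := by
    rw [lintegral_tsum fun n => (hu n).aestronglyMeasurable.enorm]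
    have h2 : ∀ n, ∫⁻ ω, ‖u n ω‖ₑ ∂P ≤ ENNReal.ofReal ((1 / 2) ^ n) := fun n => by
      rw [← ofReal_integral_norm_eq_lintegral_enorm (hu n)]
      exact ENNReal.ofReal_le_ofReal (hle n)
    refine ne_top_of_le_ne_top ?_ (ENNReal.tsum_le_tsum h2)
    exact summable_geometric_two.tsum_ofReal_ne_top
  have h3 : ∀ᵐ ω ∂P, ∑' n, ‖u n ω‖ₑ < ⊤ :=
    ae_lt_top' (AEMeasurable.tsum fun n => (hu n).aestronglyMeasurable.enorm) h1
  filter_upwards [h3] with ω hω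
  have h4 := ENNReal.tendsto_atTop_zero_of_tsum_ne_top hω.ne
  rw [tendsto_zero_iff_norm_tendsto_zero]
  have h5 := (ENNReal.tendsto_toReal ENNReal.zero_ne_top).comp h4
  refine h5.congr fun n => ?_
  simp

/-- Attainable positions with errors in `ρ` and a position which is not attainable are
separated by bounded densities that live on finitely many models. -/
theorem exists_separating_densities {ι Ω : Type*} {mT mΩ : MeasurableSpace Ω} (P : Measure Ω)
    [IsFiniteMeasure P] (hmT : mT ≤ mΩ) {I : Set ι} (hI : I.Countable) {ρ : Set ℝ}
    (hρ : IsClosed ρ) (h0 : 0 ∈ ρ) (hadd : ∀ x ∈ ρ, ∀ y ∈ ρ, x + y ∈ ρ)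
    (hmul : ∀ a : ℝ, 0 ≤ a → ∀ x ∈ ρ, a * x ∈ ρ) {N : ℕ} {m : ℕ → MeasurableSpace Ω}
    (hm : Monotone m) {X : ℕ → ι → Ω → ℝ}
    (hNA : ∀ h : ℕ → Ω → ℝ, (∀ j, Measurable[m j] (h j)) →
      (∀ θ ∈ I, ∀ᵐ ω ∂P, ∑ j ∈ Finset.range N, h j ω * X j θ ω ∈ ρ) →
      ∀ θ ∈ I, ∀ᵐ ω ∂P, ∑ j ∈ Finset.range N, h j ω * X j θ ω = 0)
    {w : ι → Ω → ℝ} (hwm : ∀ θ ∈ I, StronglyMeasurable[mT] (w θ))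
    (hw : ∀ θ ∈ I, ∀ᵐ ω ∂P, 0 < w θ ω)
    {f : ι → Ω → ℝ} (hfm : ∀ θ ∈ I, StronglyMeasurable[mT] (f θ))
    (hfi : ∀ θ ∈ I, Integrable (fun ω => w θ ω * f θ ω) P)
    (hf : ¬ ∃ h : ℕ → Ω → ℝ, (∀ j, Measurable[m j] (h j)) ∧
      ∀ θ ∈ I, ∀ᵐ ω ∂P, ∑ j ∈ Finset.range N, h j ω * X j θ ω - f θ ω ∈ ρ) :
    ∃ (J : Finset ι) (Y : ι → Ω → ℝ), (J : Set ι) ⊆ I ∧ (∀ θ, StronglyMeasurable[mT] (Y θ)) ∧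
      (∃ C : ℝ, ∀ θ, ∀ᵐ ω ∂P, |Y θ ω| ≤ C) ∧ (∀ θ ∉ J, Y θ = 0) ∧
      0 < ∑ θ ∈ J, ∫ ω, Y θ ω * (w θ ω * f θ ω) ∂P ∧
      ∀ (h : ℕ → Ω → ℝ) (g : ι → Ω → ℝ), (∀ j, Measurable[m j] (h j)) →
        (∀ θ ∈ J, StronglyMeasurable[mT] (g θ)) →
        (∀ θ ∈ J, Integrable (fun ω => w θ ω * g θ ω) P) →
        (∀ θ ∈ J, ∀ᵐ ω ∂P, ∑ j ∈ Finset.range N, h j ω * X j θ ω - g θ ω ∈ ρ) →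
        ∑ θ ∈ J, ∫ ω, Y θ ω * (w θ ω * g θ ω) ∂P ≤ 0 := by
  classical
  rcases I.eq_empty_or_nonempty with rfl | hne
  · exact absurd ⟨fun _ _ => 0, fun _ => measurable_const, by simp⟩ hf
  obtain ⟨e, rfl⟩ := hI.exists_eq_range hne
  set D : (J : Finset ι) → Set (J → Lp ℝ 1 P) := fun J => {g | ∃ h : ℕ → Ω → ℝ,
    (∀ j, Measurable[m j] (h j)) ∧ ∀ θ : J, ∀ᵐ ω ∂P,
      w θ ω * ∑ j ∈ Finset.range N, h j ω * X j θ ω - g θ ω ∈ ρ} with hD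
  set J : ℕ → Finset ι := fun n => (Finset.range n).image e with hJ
  have hJI : ∀ n, ∀ θ ∈ J n, θ ∈ Set.range e := fun n θ hθ => by
    obtain ⟨i, -, rfl⟩ := Finset.mem_image.1 hθ
    exact ⟨i, rfl⟩
  set fL : ∀ n, J n → Lp ℝ 1 P := fun n θ => (hfi θ (hJI n θ θ.2)).toL1 _ with hfL
  -- Otherwise approximations within `(1 / 2) ^ n` on the `n`-th finite set of models converge
  -- almost surely in each model, and closedness makes `f` attainable. So a finite set of models
  -- already separates.
  obtain ⟨n, hn⟩ : ∃ n, fL n ∉ closure (D (J n)) := by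
    by_contra! hcl
    have hclose : ∀ n, ∃ g ∈ D (J n), dist (fL n) g < (1 / 2) ^ n := fun n =>
      Metric.mem_closure_iff.1 (hcl n) _ (by positivity)
    choose g hgD hg using hclose
    choose h hh hhg using hgD
    refine hf (exists_portfolio_of_tendsto P (Set.range e) hρ hmul N m hm X hNA h
      -- The value `0` off `J n` is harmless: the model `e i` lies in `J n` for all `n > i`, and
      -- only the tail matters.
      (fun n θ ω => if hθ : θ ∈ J n then
        ∑ j ∈ Finset.range N, h n j ω * X j θ ω - (w θ ω)⁻¹ * g n ⟨θ, hθ⟩ ω else 0) f hh ?_ ?_)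
    · intro θ hθ
      rw [ae_all_iff]
      intro n
      by_cases hθn : θ ∈ J n
      · filter_upwards [hhg n ⟨θ, hθn⟩, hw θ hθ] with ω h1 h2
        simp only [hθn, dif_pos]
        have := hmul _ (inv_pos.2 h2).le _ h1
        rwa [mul_sub, inv_mul_cancel_left₀ h2.ne'] at this
      · simp [hθn, h0]
    · rintro θ ⟨i, rfl⟩
      have hmem : ∀ n, e i ∈ J (n + (i + 1)) := fun n =>
        Finset.mem_image_of_mem e (Finset.mem_range.2 (by omega))
      have hconv := ae_tendsto_zero_of_integral_abs_le (P := P)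
        (u := fun n ω => w (e i) ω * f (e i) ω - g (n + (i + 1)) ⟨e i, hmem n⟩ ω)
        (fun n => (hfi _ ⟨i, rfl⟩).sub (L1.integrable_coeFn _)) (fun n => by
          have h1 := (dist_le_pi_dist (fL _) (g _) ⟨e i, hmem n⟩).trans (hg (n + (i + 1))).le
          rw [dist_eq_norm, L1.norm_eq_integral_norm] at h1
          refine le_trans (le_of_eq ?_) (h1.trans
            (pow_le_pow_of_le_one (by norm_num) (by norm_num) (by omega)))
          refine integral_congr_ae ?_
          filter_upwards [Lp.coeFn_sub (fL (n + (i + 1)) ⟨e i, hmem n⟩)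
            (g (n + (i + 1)) ⟨e i, hmem n⟩), (hfi _ ⟨i, rfl⟩).coeFn_toL1] with ω h2 h3
          rw [h2, Pi.sub_apply, Real.norm_eq_abs]
          simp only [hfL, h3])
      filter_upwards [hconv, hw (e i) ⟨i, rfl⟩] with ω h1 h2
      rw [← tendsto_add_atTop_iff_nat (i + 1)]
      have h3 := (tendsto_const_nhds (x := f (e i) ω)).sub (h1.const_mul (w (e i) ω)⁻¹)
      rw [mul_zero, sub_zero] at h3
      refine h3.congr fun n => ?_
      simp only [hmem n, dif_pos]
      rw [mul_sub, inv_mul_cancel_left₀ h2.ne']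
      ring
  obtain ⟨Y, hYm, ⟨C, hYb⟩, hYf, hYD⟩ := exists_densities_of_notMem_closure (D := D (J n))
    (by
      rintro g ⟨h, hh, hg⟩ g' ⟨h', hh', hg'⟩ a b ha hb -
      refine ⟨fun j ω => a * h j ω + b * h' j ω,
        fun j => ((hh j).const_mul a).add ((hh' j).const_mul b), fun θ => ?_⟩
      filter_upwards [hg θ, hg' θ, Lp.coeFn_add (a • g θ) (b • g' θ), Lp.coeFn_smul a (g θ),
        Lp.coeFn_smul b (g' θ)] with ω h1 h2 h3 h4 h5
      have h6 := hadd _ (hmul a ha _ h1) _ (hmul b hb _ h2)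
      simp only [Pi.add_apply, Pi.smul_apply]
      rw [h3, Pi.add_apply, h4, h5, Pi.smul_apply, Pi.smul_apply, smul_eq_mul, smul_eq_mul]
      convert h6 using 1
      simp only [add_mul, Finset.sum_add_distrib, mul_assoc, ← Finset.mul_sum]
      ring)
    (by
      refine ⟨fun _ _ => 0, fun _ => measurable_const, fun θ => ?_⟩
      filter_upwards [Lp.coeFn_zero ℝ 1 P] with ω h1
      have h2 : ((0 : J n → Lp ℝ 1 P) θ : Ω → ℝ) ω = 0 := h1
      rw [h2]
      simpa using h0)
    (by
      rintro a ha g ⟨h, hh, hg⟩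
      refine ⟨fun j ω => a * h j ω, fun j => (hh j).const_mul a, fun θ => ?_⟩
      filter_upwards [hg θ, Lp.coeFn_smul a (g θ)] with ω h1 h2
      have h3 := hmul a ha _ h1
      rw [Pi.smul_apply, h2, Pi.smul_apply, smul_eq_mul]
      convert h3 using 1
      simp only [mul_assoc, ← Finset.mul_sum]
      ring) hn
  have hYi : ∀ θ, Integrable (Y θ) P := fun θ =>
    (integrable_const C).mono' (hYm θ).aestronglyMeasurable (Eventually.of_forall (hYb θ))
  have hcond : ∀ (θ : J n) (φ : Ω → ℝ), StronglyMeasurable[mT] φ → Integrable φ P →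
      ∫ ω, (P[Y θ | mT]) ω * φ ω ∂P = ∫ ω, Y θ ω * φ ω ∂P := by
    intro θ φ hφ hφi
    rw [← integral_condExp hmT (f := fun ω => Y θ ω * φ ω)]
    refine integral_congr_ae (condExp_mul_of_stronglyMeasurable_right hφ ?_ (hYi θ)).symm
    exact hφi.bdd_mul (hYm θ).aestronglyMeasurable (Eventually.of_forall (hYb θ))
  -- The test families are `mT`-measurable, so conditioning the densities on `mT` leaves all
  -- pairings unchanged.
  set Y' : ι → Ω → ℝ := fun θ => if hθ : θ ∈ J n then P[Y ⟨θ, hθ⟩ | mT] else 0 with hY'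
  have hsum : ∀ g : ι → Ω → ℝ, (∀ θ ∈ J n, StronglyMeasurable[mT] (g θ)) →
      (∀ θ ∈ J n, Integrable (fun ω => w θ ω * g θ ω) P) →
      ∑ θ ∈ J n, ∫ ω, Y' θ ω * (w θ ω * g θ ω) ∂P =
        ∑ θ : J n, ∫ ω, Y θ ω * (w θ ω * g θ ω) ∂P := by
    intro g hg hgi
    rw [← Finset.sum_coe_sort (J n)]
    refine Finset.sum_congr rfl fun θ _ => ?_
    simp only [hY', θ.2, dif_pos]
    exact hcond θ _ ((hwm θ (hJI n θ θ.2)).mul (hg θ θ.2)) (hgi θ θ.2)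
  refine ⟨J n, Y', hJI n, fun θ => ?_, ⟨max C 0, fun θ => ?_⟩, fun θ hθ => by simp [hY', hθ],
    ?_, fun h g hh hg hgi hhg => ?_⟩
  · by_cases hθ : θ ∈ J n
    · simp only [hY', hθ, dif_pos]
      exact stronglyMeasurable_condExp
    · simp only [hY', hθ, dif_neg, not_false_iff]
      exact stronglyMeasurable_zero
  · by_cases hθ : θ ∈ J n
    · simp only [hY', hθ, dif_pos]
      exact ae_bdd_abs_condExp_of_ae_bdd_abs
        (Eventually.of_forall fun ω => (hYb ⟨θ, hθ⟩ ω).trans (le_max_left _ _))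
    · simp [hY', hθ]
  · rw [hsum f (fun θ hθ => hfm θ (hJI n θ hθ)) (fun θ hθ => hfi θ (hJI n θ hθ))]
    refine hYf.trans_eq (Finset.sum_congr rfl fun θ _ => integral_congr_ae ?_)
    filter_upwards [(hfi θ (hJI n θ θ.2)).coeFn_toL1] with ω h1
    simp only [hfL, h1]
  · rw [hsum g hg hgi]
    refine le_trans (le_of_eq (Finset.sum_congr rfl fun θ _ => integral_congr_ae ?_))
      (hYD (fun θ => (hgi θ θ.2).toL1 _) ⟨h, hh, fun θ => ?_⟩)
    · filter_upwards [(hgi θ θ.2).coeFn_toL1] with ω h1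
      rw [h1]
    · filter_upwards [(hgi θ θ.2).coeFn_toL1, hhg θ θ.2, hw θ (hJI n θ θ.2)] with ω h1 h2 h3
      rw [h1, ← mul_sub]
      exact hmul _ h3.le _ h2

/-! ### Martingale transforms in discrete time -/

/-- Vanishing integrals over `m`-measurable sets mean that the conditional expectation is zero, and
`φ` can be pulled out of it. -/
theorem integral_mul_eq_zero_of_forall_setIntegral_eq_zero {E : Type*} {m mE : MeasurableSpace E}
    {μ : Measure E} [IsFiniteMeasure μ] (hm : m ≤ mE) {X φ : E → ℝ} (hX : Integrable X μ)
    (hX0 : ∀ A, MeasurableSet[m] A → ∫ x in A, X x ∂μ = 0) (hφ : StronglyMeasurable[m] φ) {C : ℝ}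
    (hC : ∀ x, |φ x| ≤ C) : ∫ x, φ x * X x ∂μ = 0 := by
  have hcond : (0 : E → ℝ) =ᵐ[μ] μ[X | m] :=
    ae_eq_condExp_of_forall_setIntegral_eq hm hX (fun _ _ _ => integrableOn_zero)
      (fun A hA _ => by simp [hX0 A hA]) stronglyMeasurable_zero.aestronglyMeasurable
  have hφX : Integrable (fun x => φ x * X x) μ :=
    hX.bdd_mul (hφ.mono hm).aestronglyMeasurable (Eventually.of_forall hC)
  rw [← integral_condExp hm (f := fun x => φ x * X x)]
  refine integral_eq_zero_of_ae ?_
  filter_upwards [condExp_mul_of_stronglyMeasurable_left hφ hφX hX, hcond] with x h1 h2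
  have h3 : (μ[fun x => φ x * X x | m]) x = φ x * (μ[X | m]) x := h1
  rw [h3, ← h2]
  simp

/-- In discrete time, a generalized martingale transform which is bounded below by an integrable
function has constant expectation. -/
theorem integral_add_sum_mul_eq {E : Type*} {mE : MeasurableSpace E} (μ : Measure E)
    [IsFiniteMeasure μ] {m : ℕ → MeasurableSpace E} (hm : Monotone m) (hmE : ∀ j, m j ≤ mE) (N : ℕ)
    {X : ℕ → E → ℝ} (hX : ∀ j < N, Integrable (X j) μ)
    (hX0 : ∀ j < N, ∀ A, MeasurableSet[m j] A → ∫ x in A, X j x ∂μ = 0) {b : E → ℝ}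
    (hb : Integrable b μ) {h : ℕ → E → ℝ} (hh : ∀ j, Measurable[m j] (h j))
    (hpos : ∀ᵐ x ∂μ, 0 ≤ b x + ∑ j ∈ Finset.range N, h j x * X j x) :
    Integrable (fun x => b x + ∑ j ∈ Finset.range N, h j x * X j x) μ ∧
      ∫ x, b x + ∑ j ∈ Finset.range N, h j x * X j x ∂μ = ∫ x, b x ∂μ := by
  set Y : ℕ → E → ℝ := fun k x => b x + ∑ j ∈ Finset.range k, h j x * X j x with hY
  have hterm : ∀ j < N, ∀ A, MeasurableSet[mE] A → (∃ C, ∀ x ∈ A, |h j x| ≤ C) →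
      IntegrableOn (fun x => h j x * X j x) A μ := by
    rintro j hj A hA ⟨C, hC⟩
    refine (hX j hj).integrableOn.bdd_mul (c := C)
      ((hh j).mono (hmE j) le_rfl).aestronglyMeasurable ?_
    exact (ae_restrict_iff' hA).2 (Eventually.of_forall hC)
  have hYint : ∀ k ≤ N, ∀ A, MeasurableSet[mE] A → (∃ C, ∀ j < k, ∀ x ∈ A, |h j x| ≤ C) →
      IntegrableOn (Y k) A μ := by
    rintro k hk A hA ⟨C, hC⟩
    refine hb.integrableOn.add (integrable_finsetSum _ fun j hj => ?_)
    have hj' := Finset.mem_range.1 hj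
    exact hterm j (hj'.trans_le hk) A hA ⟨C, hC j hj'⟩
  -- Backward induction over the dates. Intermediate values need not be integrable, so the claim is
  -- localised to sets where the earlier positions are bounded; at `i = N` no earlier position is
  -- left.
  have claim : ∀ i ≤ N, ∀ A, MeasurableSet[m (N - i)] A →
      (∃ C, ∀ j < N - i, ∀ x ∈ A, |h j x| ≤ C) →
      IntegrableOn (Y N) A μ ∧ ∫ x in A, Y N x ∂μ = ∫ x in A, Y (N - i) x ∂μ := by
    intro i
    induction i with
    | zero => exact fun _ A hA hC => ⟨hYint N le_rfl A (hmE _ _ hA) (by simpa using hC), by simp⟩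
    | succ i ih =>
      rintro hi A hA ⟨C, hC⟩
      obtain ⟨k, hk⟩ : ∃ k, k = N - (i + 1) := ⟨_, rfl⟩
      have hk1 : N - i = k + 1 := by omega
      rw [← hk] at hA hC ⊢
      rw [hk1] at ih
      have hAE := hmE _ _ hA
      set φ : ℕ → Set E := fun n => {x | |h k x| ≤ n} with hφ
      have hφm : ∀ n, MeasurableSet[m k] (φ n) := fun n =>
        (measurable_norm.comp (hh k)) measurableSet_Iic
      have hcover : AECover (μ.restrict A) atTop φ := by
        refine ⟨Eventually.of_forall fun x => ?_, fun n => hmE _ _ (hφm n)⟩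
        obtain ⟨n, hn⟩ := exists_nat_ge |h k x|
        filter_upwards [eventually_ge_atTop n] with l hl
        exact hn.trans (Nat.cast_le.2 hl)
      have hstep : ∀ n, IntegrableOn (Y N) (φ n ∩ A) μ ∧
          ∫ x in φ n ∩ A, Y N x ∂μ = ∫ x in φ n ∩ A, Y k x ∂μ := by
        intro n
        have hm1 : MeasurableSet[m k] (φ n ∩ A) := (hφm n).inter hA
        have hbd : ∃ C', ∀ j < k + 1, ∀ x ∈ φ n ∩ A, |h j x| ≤ C' := by
          refine ⟨max C n, fun j hj x hx => ?_⟩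
          rcases Nat.lt_succ_iff_lt_or_eq.1 hj with h1 | rfl
          · exact (hC j h1 x hx.2).trans (le_max_left _ _)
          · exact hx.1.trans (le_max_right _ _)
        obtain ⟨h1, h2⟩ := ih (by omega) (φ n ∩ A) (hm (Nat.le_succ k) _ hm1) hbd
        refine ⟨h1, h2.trans ?_⟩
        have h3 : Y (k + 1) = fun x => Y k x + h k x * X k x := by
          ext x; simp only [hY, Finset.sum_range_succ]; ring
        obtain ⟨C', hC'⟩ := hbd
        rw [h3, integral_add (hYint k (by omega) _ (hmE _ _ hm1)
          ⟨C', fun j hj => hC' j (by omega)⟩) (hterm k (by omega) _ (hmE _ _ hm1)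
          ⟨C', hC' k (by omega)⟩), add_eq_left, ← integral_indicator (hmE _ _ hm1)]
        have h4 := integral_mul_eq_zero_of_forall_setIntegral_eq_zero (hmE k) (hX k (by omega))
          (hX0 k (by omega)) (φ := (φ n ∩ A).indicator (h k))
          ((hh k).stronglyMeasurable.indicator hm1) (C := max C' 0) (fun x => by
            by_cases hx : x ∈ φ n ∩ A
            · rw [Set.indicator_of_mem hx]
              exact (hC' k (by omega) x hx).trans (le_max_left _ _)
            · rw [Set.indicator_of_notMem hx, abs_zero]
              exact le_max_right _ _)
        rw [← h4]
        refine integral_congr_ae (Eventually.of_forall fun x => ?_)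
        by_cases hx : x ∈ φ n ∩ A <;> simp [hx]
      have hYk : Integrable (Y k) (μ.restrict A) := hYint k (by omega) A hAE ⟨C, hC⟩
      have hrest : ∀ n, (μ.restrict A).restrict (φ n) = μ.restrict (φ n ∩ A) := fun n =>
        Measure.restrict_restrict (hmE _ _ (hφm n))
      have hlim := hcover.integral_tendsto_of_countably_generated hYk
      -- On the sets `|h k| ≤ n` the integrals of the nonnegative `Y N` equal those of `Y k`, which
      -- converge. They are thus bounded, and monotone convergence gives integrability.
      have hint : Integrable (Y N) (μ.restrict A) := by
        refine hcover.integrable_of_integral_bounded_of_nonneg_ae (∫ x in A, Y k x ∂μ + 1)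
          (fun n => ?_) (ae_restrict_of_ae hpos) ?_
        · rw [IntegrableOn, hrest]; exact (hstep n).1
        · filter_upwards [hlim.eventually (gt_mem_nhds (lt_add_one _))] with n hn
          rw [hrest] at hn ⊢
          rw [(hstep n).2]
          exact hn.le
      refine ⟨hint, tendsto_nhds_unique (hcover.integral_tendsto_of_countably_generated hint)
        (hlim.congr fun n => ?_)⟩
      rw [hrest, (hstep n).2]
  have := claim N le_rfl Set.univ MeasurableSet.univ ⟨0, fun j hj => absurd hj (by omega)⟩
  simpa [hY] using this

/-- The version of `integral_add_sum_mul_eq` for finitely many models. -/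
theorem sum_integral_add_sum_mul_eq {ι Ω : Type*} {mΩ : MeasurableSpace Ω} (P : Measure Ω)
    [IsFiniteMeasure P] (J : Finset ι) {m : ℕ → MeasurableSpace Ω} (hm : Monotone m)
    (hmΩ : ∀ j, m j ≤ mΩ) (N : ℕ) {X : ℕ → ι → Ω → ℝ}
    (hX : ∀ j < N, ∀ θ ∈ J, Integrable (X j θ) P)
    (hX0 : ∀ j < N, ∀ A, MeasurableSet[m j] A → ∑ θ ∈ J, ∫ ω in A, X j θ ω ∂P = 0)
    {b : ι → Ω → ℝ} (hb : ∀ θ ∈ J, Integrable (b θ) P) {h : ℕ → Ω → ℝ}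
    (hh : ∀ j, Measurable[m j] (h j))
    (hpos : ∀ θ ∈ J, ∀ᵐ ω ∂P, 0 ≤ b θ ω + ∑ j ∈ Finset.range N, h j ω * X j θ ω) :
    ∑ θ ∈ J, ∫ ω, b θ ω + ∑ j ∈ Finset.range N, h j ω * X j θ ω ∂P =
      ∑ θ ∈ J, ∫ ω, b θ ω ∂P := by
  let : MeasurableSpace J := ⊤
  have hemb : ∀ θ : J, MeasurableEmbedding (fun ω : Ω => (θ, ω)) := fun θ =>
    measurableEmbedding_prodMk_left θ
  -- On the disjoint union of the models, with the filtration pulled back from `Ω` and so blind to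
  -- `θ`, a generalized martingale is an ordinary one.
  set μ : Measure (J × Ω) := ∑ θ : J, P.map (fun ω => (θ, ω)) with hμ
  have hint : ∀ f : J × Ω → ℝ, (∀ θ : J, Integrable (fun ω => f (θ, ω)) P) → Integrable f μ := by
    intro f hf
    rw [hμ, integrable_finsetSum_measure]
    exact fun θ _ => (hemb θ).integrable_map_iff.2 (hf θ)
  have hval : ∀ f : J × Ω → ℝ, Integrable f μ →
      ∫ p, f p ∂μ = ∑ θ : J, ∫ ω, f (θ, ω) ∂P := by
    intro f hf
    rw [hμ, integrable_finsetSum_measure] at hf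
    rw [hμ, integral_finsetSum_measure hf]
    exact Finset.sum_congr rfl fun θ _ => (hemb θ).integral_map _
  have hfin : IsFiniteMeasure μ := by
    refine ⟨?_⟩
    rw [hμ, Measure.finsetSum_apply]
    refine ENNReal.sum_lt_top.2 fun θ _ => ?_
    rw [(hemb θ).map_apply]
    exact measure_lt_top _ _
  have hbμ : Integrable (fun p : J × Ω => b p.1 p.2) μ := hint _ fun θ => hb θ θ.2
  have key := integral_add_sum_mul_eq μ (m := fun j => (m j).comap Prod.snd)
    (fun i j hij => MeasurableSpace.comap_mono (hm hij))
    (fun j => (MeasurableSpace.comap_mono (hmΩ j)).trans measurable_snd.comap_le) N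
    (X := fun j p => X j p.1 p.2) (fun j hj => hint _ fun θ => hX j hj θ θ.2)
    (by
      rintro j hj _ ⟨A, hA, rfl⟩
      have hA' : MeasurableSet (Prod.snd ⁻¹' A : Set (J × Ω)) := measurable_snd (hmΩ j _ hA)
      rw [← integral_indicator hA', hval _ ((hint (fun p : J × Ω => X j p.1 p.2)
        fun θ => hX j hj θ θ.2).indicator hA'), ← hX0 j hj A hA, ← Finset.sum_coe_sort J]
      refine Finset.sum_congr rfl fun θ _ => ?_
      rw [← integral_indicator (hmΩ j _ hA)]
      rfl)
    hbμ (h := fun j p => h j p.2) (fun j => (hh j).comp (comap_measurable _))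
    (by
      rw [hμ, ae_finsetSum_measure_iff]
      exact fun θ _ => (hemb θ).ae_map_iff.2 (hpos θ θ.2))
  rw [hval _ key.1, hval _ hbμ] at key
  rw [← Finset.sum_coe_sort J, ← Finset.sum_coe_sort J]
  exact key.2

/-! ### Strategies as scalar positions in the increments -/

/-- The price increments, with dates and coordinates enumerated by a single index: the index `j`
stands for the coordinate `j % d` over the period from `j / d` to `j / d + 1`. -/
noncomputable def increment {ι Ω : Type*} {d : ℕ} (hd : 1 ≤ d)
    (S : ι → ℕ → Ω → EuclideanSpace ℝ (Fin d)) (j : ℕ) (θ : ι) (ω : Ω) : ℝ :=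
  (S θ (j / d + 1) ω - S θ (j / d) ω) ⟨j % d, Nat.mod_lt j hd⟩

/-- The strategy which holds `h j` units of the increment with index `j`. -/
noncomputable def strategyOf {Ω : Type*} (d : ℕ) (h : ℕ → Ω → ℝ) :
    ℕ → Ω → EuclideanSpace ℝ (Fin d) :=
  fun t ω => WithLp.toLp 2 fun i => h ((t - 1) * d + i) ω

theorem sum_range_mul_eq {d : ℕ} (hd : 1 ≤ d) (T : ℕ) (f : ℕ → Fin d → ℝ) :
    ∑ j ∈ Finset.range (T * d), f (j / d) ⟨j % d, Nat.mod_lt j hd⟩ =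
      ∑ t ∈ Finset.range T, ∑ i, f t i := by
  induction T with
  | zero => simp
  | succ T ih =>
    rw [Nat.succ_mul, Finset.sum_range_add, ih, Finset.sum_range_succ]
    congr 1
    rw [Finset.sum_range]
    refine Finset.sum_congr rfl fun i _ => ?_
    have h1 : (T * d + i) / d = T := by
      rw [mul_comm, Nat.mul_add_div (by omega), Nat.div_eq_of_lt i.2, add_zero]
    have h2 : (T * d + i) % d = i := by
      rw [mul_comm, Nat.mul_add_mod, Nat.mod_eq_of_lt i.2]
    simp only [h1, h2]

theorem gains_eq_sum {ι Ω : Type*} {d : ℕ} (hd : 1 ≤ d)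
    (S : ι → ℕ → Ω → EuclideanSpace ℝ (Fin d)) (H : ℕ → Ω → EuclideanSpace ℝ (Fin d)) (T : ℕ)
    (θ : ι) (ω : Ω) :
    gains H (S θ) T ω = ∑ j ∈ Finset.range (T * d),
      H (j / d + 1) ω ⟨j % d, Nat.mod_lt j hd⟩ * increment hd S j θ ω := by
  refine Eq.trans ?_ (sum_range_mul_eq hd T fun t i =>
    H (t + 1) ω i * (S θ (t + 1) ω - S θ t ω) i).symm
  refine Finset.sum_congr rfl fun t _ => ?_
  simp [PiLp.inner_apply, mul_comm]

theorem gains_strategyOf {ι Ω : Type*} {d : ℕ} (hd : 1 ≤ d)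
    (S : ι → ℕ → Ω → EuclideanSpace ℝ (Fin d)) (h : ℕ → Ω → ℝ) (T : ℕ) (θ : ι) (ω : Ω) :
    gains (strategyOf d h) (S θ) T ω =
      ∑ j ∈ Finset.range (T * d), h j ω * increment hd S j θ ω := by
  rw [gains_eq_sum hd]
  refine Finset.sum_congr rfl fun j _ => ?_
  simp [strategyOf, Nat.div_add_mod']

theorem isStrategy_strategyOf {Ω : Type*} {mΩ : MeasurableSpace Ω} {d : ℕ} (hd : 1 ≤ d)
    {F : Filtration ℕ mΩ} (T : ℕ) {h : ℕ → Ω → ℝ} (hh : ∀ j, Measurable[F (j / d)] (h j)) :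
    IsStrategy F T (strategyOf d h) := by
  intro t _
  refine (WithLp.measurable_toLp 2 _).comp (@measurable_pi_lambda _ _ _ (F t) _ _ fun i => ?_)
  have := hh (t * d + i)
  rw [mul_comm t d, Nat.mul_add_div (by omega), Nat.div_eq_of_lt i.2, add_zero] at this
  simpa [mul_comm] using this

theorem measurable_coord_of_isStrategy {Ω : Type*} {mΩ : MeasurableSpace Ω} {d : ℕ} (hd : 1 ≤ d)
    {F : Filtration ℕ mΩ} {T : ℕ} {H : ℕ → Ω → EuclideanSpace ℝ (Fin d)} (hH : IsStrategy F T H)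
    {j : ℕ} (hj : j < T * d) :
    Measurable[F (j / d)] fun ω => H (j / d + 1) ω ⟨j % d, Nat.mod_lt j hd⟩ :=
  ((measurable_pi_apply (⟨j % d, Nat.mod_lt j hd⟩ : Fin d)).comp
    (WithLp.measurable_ofLp 2 _)).comp (hH _ (Nat.div_lt_of_lt_mul (by rwa [mul_comm])))

/-- Every strategy is given by real-valued positions in the increments. -/
theorem exists_gains_eq_sum {ι Ω : Type*} {mΩ : MeasurableSpace Ω} {d : ℕ} (hd : 1 ≤ d)
    {F : Filtration ℕ mΩ} {T : ℕ} (S : ι → ℕ → Ω → EuclideanSpace ℝ (Fin d))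
    {H : ℕ → Ω → EuclideanSpace ℝ (Fin d)} (hH : IsStrategy F T H) :
    ∃ h : ℕ → Ω → ℝ, (∀ j, Measurable[F (j / d)] (h j)) ∧ ∀ θ ω, gains H (S θ) T ω =
      ∑ j ∈ Finset.range (T * d), h j ω * increment hd S j θ ω := by
  classical
  refine ⟨fun j => if j < T * d then fun ω => H (j / d + 1) ω ⟨j % d, Nat.mod_lt j hd⟩ else 0,
    fun j => ?_, fun θ ω => ?_⟩
  · dsimp only
    split_ifs with hj
    · exact measurable_coord_of_isStrategy hd hH hj
    · exact measurable_const
  · rw [gains_eq_sum hd]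
    refine Finset.sum_congr rfl fun j hj => ?_
    simp only [if_pos (Finset.mem_range.1 hj)]

theorem monotone_filtration_div {Ω : Type*} {mΩ : MeasurableSpace Ω} (F : Filtration ℕ mΩ)
    (d : ℕ) : Monotone fun j => F (j / d) :=
  fun _ _ hij => F.mono (Nat.div_le_div_right hij)

theorem measurable_increment {ι Ω : Type*} {mΩ : MeasurableSpace Ω} {d : ℕ} (hd : 1 ≤ d)
    {F : Filtration ℕ mΩ} {T : ℕ} {S : ι → ℕ → Ω → EuclideanSpace ℝ (Fin d)}
    (hS : ∀ θ, ∀ t ≤ T, Measurable[F t] (S θ t)) {j : ℕ} (hj : j < T * d) (θ : ι) :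
    Measurable[F T] (increment hd S j θ) := by
  have hjT : j / d < T := Nat.div_lt_of_lt_mul (by rwa [mul_comm])
  have h1 : Measurable[F T] (S θ (j / d + 1)) := (hS θ _ hjT).mono (F.mono hjT) le_rfl
  have h2 : Measurable[F T] (S θ (j / d)) := (hS θ _ hjT.le).mono (F.mono hjT.le) le_rfl
  exact ((measurable_pi_apply (⟨j % d, Nat.mod_lt j hd⟩ : Fin d)).comp
    (WithLp.measurable_ofLp 2 _)).comp (h1.sub h2)

/-! ### Pricing systems: the scalar martingale property and replication prices -/

section Pricing

variable {ι Ω : Type*} {mΩ : MeasurableSpace Ω} {P : Measure Ω} {F : Filtration ℕ mΩ} {T d : ℕ}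

theorem density_eq_zero_of_notMem {Z : DualSpace ι P F T} {θ : ι} (hθ : θ ∉ Z.support) :
    density Z θ =ᵐ[P] 0 := by
  rw [density, Finsupp.notMem_support_iff.1 hθ]
  exact Lp.coeFn_zero ℝ ⊤ P

theorem pricing_eq_sum {E : Type*} [NormedAddCommGroup E] [NormedSpace ℝ E]
    {Z : DualSpace ι P F T} {J : Finset ι} (hJ : Z.support ⊆ J) (f : ι → Ω → E) :
    pricing Z f = ∑ θ ∈ J, ∫ ω, density Z θ ω • f θ ω ∂P := by
  refine Finset.sum_subset hJ fun θ _ hθ => integral_eq_zero_of_ae ?_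
  filter_upwards [density_eq_zero_of_notMem hθ] with ω h
  simp [h]

theorem aestronglyMeasurable_density (Z : DualSpace ι P F T) (θ : ι) :
    AEStronglyMeasurable[F T] (density Z θ) P :=
  mem_lpMeas_iff_aestronglyMeasurable.1 (Z θ).2

theorem memLp_density (Z : DualSpace ι P F T) (θ : ι) : MemLp (density Z θ) ⊤ P :=
  Lp.memLp _

theorem integrable_density [IsFiniteMeasure P] (Z : DualSpace ι P F T) (θ : ι) :
    Integrable (density Z θ) P :=
  (memLp_density Z θ).integrable le_top

theorem exists_dualSpace_density_ae_eq (J : Finset ι) {z : ι → Ω → ℝ}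
    (hzm : ∀ θ, AEStronglyMeasurable[F T] (z θ) P) (hzb : ∀ θ, ∃ C : ℝ, ∀ᵐ ω ∂P, |z θ ω| ≤ C)
    (hz0 : ∀ θ ∉ J, z θ =ᵐ[P] 0) :
    ∃ Z : DualSpace ι P F T, Z.support ⊆ J ∧ ∀ θ, density Z θ =ᵐ[P] z θ := by
  classical
  have hmem : ∀ θ, MemLp (z θ) ⊤ P := fun θ => by
    obtain ⟨C, hC⟩ := hzb θ
    exact memLp_top_of_bound ((hzm θ).mono (F.le T)) C hC
  refine ⟨Finsupp.onFinset J (fun θ => ⟨(hmem θ).toLp _, ?_⟩) fun θ hθ => ?_,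
    Finsupp.support_onFinset_subset, fun θ => (hmem θ).coeFn_toLp⟩
  · rw [mem_lpMeas_iff_aestronglyMeasurable]
    exact (hzm θ).congr (hmem θ).coeFn_toLp.symm
  · by_contra h
    refine hθ (Subtype.ext ?_)
    refine Lp.ext ((hmem θ).coeFn_toLp.trans ((hz0 θ h).trans ?_))
    exact (Lp.coeFn_zero ℝ ⊤ P).symm

theorem integrable_smul_coord {z : Ω → ℝ} {M : Ω → EuclideanSpace ℝ (Fin d)}
    (h : Integrable (fun ω => z ω • M ω) P) (i : Fin d) : Integrable (fun ω => z ω * M ω i) P :=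
  (EuclideanSpace.proj i : EuclideanSpace ℝ (Fin d) →L[ℝ] ℝ).integrable_comp h

theorem integrable_smul_indicator {E : Type*} [NormedAddCommGroup E] [NormedSpace ℝ E] {z : Ω → ℝ}
    {M : Ω → E} (h : Integrable (fun ω => z ω • M ω) P) {A : Set Ω} (hA : MeasurableSet A) :
    Integrable (fun ω => z ω • A.indicator M ω) P := by
  have h1 := h.indicator hA
  rwa [Set.indicator_smul] at h1

theorem sum_integral_smul_indicator_apply (J : Finset ι) {z : ι → Ω → ℝ}
    {M : ι → Ω → EuclideanSpace ℝ (Fin d)} (h : ∀ θ, Integrable (fun ω => z θ ω • M θ ω) P)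
    {A : Set Ω} (hA : MeasurableSet A) (i : Fin d) :
    (∑ θ ∈ J, ∫ ω, z θ ω • A.indicator (M θ) ω ∂P) i =
      ∑ θ ∈ J, ∫ ω in A, z θ ω * M θ ω i ∂P := by
  have h1 := map_sum (EuclideanSpace.proj i : EuclideanSpace ℝ (Fin d) →L[ℝ] ℝ)
    (fun θ => ∫ ω, z θ ω • A.indicator (M θ) ω ∂P) J
  refine h1.trans (Finset.sum_congr rfl fun θ _ => ?_)
  rw [← ContinuousLinearMap.integral_comp_comm _ (integrable_smul_indicator (h θ) hA),
    ← integral_indicator hA]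
  refine integral_congr_ae (Eventually.of_forall fun ω => ?_)
  by_cases hω : ω ∈ A <;> simp [hω]

/-- The real-valued form of the martingale property. -/
theorem IsRobustPricingSystem.sum_setIntegral_increment (hd : 1 ≤ d)
    {S : ι → ℕ → Ω → EuclideanSpace ℝ (Fin d)} {Z : DualSpace ι P F T}
    (hZ : IsRobustPricingSystem S Z) {j : ℕ} (hj : j < T * d) {A : Set Ω}
    (hA : MeasurableSet[F (j / d)] A) :
    ∑ θ ∈ Z.support, ∫ ω in A, density Z θ ω * increment hd S j θ ω ∂P = 0 := by
  have hjT : j / d < T := Nat.div_lt_of_lt_mul (by rwa [mul_comm])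
  have hA' := F.le _ _ hA
  have hi1 := fun θ => hZ.martingale.integrable_density θ (j / d + 1) hjT
  have hi0 := fun θ => hZ.martingale.integrable_density θ (j / d) hjT.le
  have h1 := congrArg (fun v : EuclideanSpace ℝ (Fin d) => v ⟨j % d, Nat.mod_lt j hd⟩)
    (hZ.martingale.pricing_eq (j / d) (j / d + 1) (Nat.le_succ _) hjT A hA)
  simp only [pricing] at h1
  rw [sum_integral_smul_indicator_apply _ hi1 hA', sum_integral_smul_indicator_apply _ hi0 hA',
    ← sub_eq_zero, ← Finset.sum_sub_distrib] at h1
  rw [← h1]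
  refine Finset.sum_congr rfl fun θ _ => ?_
  rw [← integral_sub (integrable_smul_coord (hi1 θ) _).integrableOn
    (integrable_smul_coord (hi0 θ) _).integrableOn]
  refine integral_congr_ae (Eventually.of_forall fun ω => ?_)
  simp only [increment, PiLp.sub_apply]
  ring

theorem IsRobustPricingSystem.integrable_increment (hd : 1 ≤ d)
    {S : ι → ℕ → Ω → EuclideanSpace ℝ (Fin d)} {Z : DualSpace ι P F T}
    (hZ : IsRobustPricingSystem S Z) {j : ℕ} (hj : j < T * d) (θ : ι) :
    Integrable (fun ω => density Z θ ω * increment hd S j θ ω) P := by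
  have hjT : j / d < T := Nat.div_lt_of_lt_mul (by rwa [mul_comm])
  refine ((integrable_smul_coord (hZ.martingale.integrable_density θ (j / d + 1) hjT)
    ⟨j % d, Nat.mod_lt j hd⟩).sub (integrable_smul_coord
      (hZ.martingale.integrable_density θ (j / d) hjT.le) ⟨j % d, Nat.mod_lt j hd⟩)).congr ?_
  refine Eventually.of_forall fun ω => ?_
  simp only [increment, PiLp.sub_apply, Pi.sub_apply]
  ring

theorem IsRobustPricingSystem.sum_integral_density {S : ι → ℕ → Ω → EuclideanSpace ℝ (Fin d)}
    {Z : DualSpace ι P F T} (hZ : IsRobustPricingSystem S Z) :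
    ∑ θ ∈ Z.support, ∫ ω, density Z θ ω ∂P = 1 := by
  simpa [pricing] using hZ.pricing_one

/-- A replicable nonnegative position has the replication price under each pricing system. -/
theorem IsRobustPricingSystem.pricing_eq_of_replicates [IsFiniteMeasure P] (hd : 1 ≤ d)
    {S : ι → ℕ → Ω → EuclideanSpace ℝ (Fin d)} {Z : DualSpace ι P F T}
    (hZ : IsRobustPricingSystem S Z) {f : ι → Ω → ℝ} (hf : ∀ θ, ∀ᵐ ω ∂P, 0 ≤ f θ ω) {x : ℝ}
    {H : ℕ → Ω → EuclideanSpace ℝ (Fin d)} (hH : IsStrategy F T H)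
    (hxH : ∀ θ, ∀ᵐ ω ∂P, x + gains H (S θ) T ω = f θ ω) : pricing Z f = x := by
  obtain ⟨h, hh, hgains⟩ := exists_gains_eq_sum hd S hH
  have hrep : ∀ θ, ∀ᵐ ω ∂P, x * density Z θ ω + ∑ j ∈ Finset.range (T * d),
      h j ω * (density Z θ ω * increment hd S j θ ω) = density Z θ ω * f θ ω := fun θ => by
    filter_upwards [hxH θ] with ω h1
    rw [← h1, hgains, mul_add, Finset.mul_sum, mul_comm x]
    congr 1
    exact Finset.sum_congr rfl fun j _ => by ring
  -- Nonnegativity of the claim replaces any integrability of the strategy: `Z f` is `x Z` plus a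
  -- transform bounded below.
  have key := sum_integral_add_sum_mul_eq P Z.support (monotone_filtration_div F d)
    (fun j => F.le _) (T * d) (X := fun j θ ω => density Z θ ω * increment hd S j θ ω)
    (fun j hj θ _ => hZ.integrable_increment hd hj θ)
    (fun j hj A hA => hZ.sum_setIntegral_increment hd hj hA)
    (b := fun θ ω => x * density Z θ ω) (fun θ _ => (integrable_density Z θ).const_mul x) hh
    (fun θ _ => by
      filter_upwards [hrep θ, hf θ, hZ.nonneg θ] with ω h1 h2 h3
      rw [h1]
      exact mul_nonneg h3 h2)
  have h2 : pricing Z f = ∑ θ ∈ Z.support, ∫ ω, x * density Z θ ω +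
      ∑ j ∈ Finset.range (T * d), h j ω * (density Z θ ω * increment hd S j θ ω) ∂P :=
    Finset.sum_congr rfl fun θ _ => (integral_congr_ae (hrep θ)).symm
  rw [h2, key]
  simp only [integral_const_mul]
  rw [← Finset.mul_sum, hZ.sum_integral_density, mul_one]

/-- A family of bounded densities with the real-valued martingale property is a robust pricing
system. -/
theorem exists_isRobustPricingSystem [IsFiniteMeasure P] (hd : 1 ≤ d)
    {S : ι → ℕ → Ω → EuclideanSpace ℝ (Fin d)} (hS : ∀ θ, ∀ t ≤ T, Measurable[F t] (S θ t))
    (J : Finset ι) {z : ι → Ω → ℝ} (hzm : ∀ θ, AEStronglyMeasurable[F T] (z θ) P)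
    (hzb : ∀ θ, ∃ C : ℝ, ∀ᵐ ω ∂P, |z θ ω| ≤ C) (hz0 : ∀ θ ∉ J, z θ =ᵐ[P] 0)
    (hnn : ∀ θ, ∀ᵐ ω ∂P, 0 ≤ z θ ω) (hone : ∑ θ ∈ J, ∫ ω, z θ ω ∂P = 1)
    (hint : ∀ θ, ∀ t ≤ T, Integrable (fun ω => z θ ω • S θ t ω) P)
    (hmart : ∀ j < T * d, ∀ A, MeasurableSet[F (j / d)] A →
      ∑ θ ∈ J, ∫ ω in A, z θ ω * increment hd S j θ ω ∂P = 0) :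
    ∃ Z : DualSpace ι P F T, IsRobustPricingSystem S Z ∧ ∀ θ, density Z θ =ᵐ[P] z θ := by
  obtain ⟨Z, hZJ, hZ⟩ := exists_dualSpace_density_ae_eq J hzm hzb hz0
  have hprice : ∀ {E : Type} [NormedAddCommGroup E] [NormedSpace ℝ E] (f : ι → Ω → E),
      pricing Z f = ∑ θ ∈ J, ∫ ω, z θ ω • f θ ω ∂P := by
    intro E _ _ f
    rw [pricing_eq_sum hZJ]
    refine Finset.sum_congr rfl fun θ _ => integral_congr_ae ?_
    filter_upwards [hZ θ] with ω h
    rw [h]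
  have hint' : ∀ θ, ∀ t ≤ T, Integrable (fun ω => density Z θ ω • S θ t ω) P :=
    fun θ t ht => (hint θ t ht).congr (by filter_upwards [hZ θ] with ω h; rw [h])
  refine ⟨Z, ⟨fun θ => ?_, ?_, ?_, ⟨hS, hint', fun t ht => ?_, ?_⟩⟩, hZ⟩
  · filter_upwards [hZ θ, hnn θ] with ω h1 h2
    rwa [h1]
  · obtain ⟨θ, -, hθ⟩ : ∃ θ ∈ J, 0 < ∫ ω, z θ ω ∂P := by
      refine Finset.exists_lt_of_sum_lt (f := fun _ => (0 : ℝ)) ?_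
      rw [hone]
      simp
    refine ⟨θ, Set.univ, MeasurableSet.univ, ?_⟩
    rw [setIntegral_univ, integral_congr_ae (hZ θ)]
    exact hθ
  · rw [hprice]
    simpa using hone
  -- The product `E[Z | F t] S t` is the conditional expectation of `Z S t`.
  · refine integrable_finsetSum _ fun θ _ => ?_
    refine (integrable_condExp (m := F t)).congr
      (condExp_smul_of_aestronglyMeasurable_right (integrable_density Z θ) (hint' θ t ht) ?_)
    exact (hS θ t ht).stronglyMeasurable.aestronglyMeasurable
  · intro s t hst
    induction t, hst using Nat.le_induction with
    | base => exact fun _ _ _ => rfl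
    | succ t hst ih =>
      intro ht A hA
      refine Eq.trans ?_ (ih (by omega) A hA)
      have hA' := F.le _ _ hA
      rw [hprice, hprice]
      ext i
      rw [sum_integral_smul_indicator_apply _ (fun θ => hint θ _ ht) hA',
        sum_integral_smul_indicator_apply _ (fun θ => hint θ _ (by omega)) hA', ← sub_eq_zero,
        ← Finset.sum_sub_distrib]
      have h1 : (t * d + i) / d = t := by
        rw [mul_comm, Nat.mul_add_div (by omega), Nat.div_eq_of_lt i.2, add_zero]
      have h2 : (t * d + i) % d = i := by
        rw [mul_comm, Nat.mul_add_mod, Nat.mod_eq_of_lt i.2]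
      rw [← hmart (t * d + i) (by nlinarith [i.2]) A (by rw [h1]; exact F.mono hst _ hA)]
      refine Finset.sum_congr rfl fun θ _ => ?_
      rw [← integral_sub (integrable_smul_coord (hint θ _ ht) _).integrableOn
        (integrable_smul_coord (hint θ _ (by omega)) _).integrableOn]
      refine integral_congr_ae (Eventually.of_forall fun ω => ?_)
      simp only [increment, h1, h2, PiLp.sub_apply]
      ring

end Pricing

/-! ### Existence of pricing systems charging a given event -/

section Existence

variable {ι Ω : Type*} {mΩ : MeasurableSpace Ω} {P : Measure Ω} {F : Filtration ℕ mΩ} {T d : ℕ}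

/-- The inverse of `1 + ∑ t ≤ T, ‖S t‖`. -/
noncomputable def weight (S : ι → ℕ → Ω → EuclideanSpace ℝ (Fin d)) (T : ℕ) (θ : ι) (ω : Ω) : ℝ :=
  (1 + ∑ t ∈ Finset.range (T + 1), ‖S θ t ω‖)⁻¹

theorem weight_pos (S : ι → ℕ → Ω → EuclideanSpace ℝ (Fin d)) (T : ℕ) (θ : ι) (ω : Ω) :
    0 < weight S T θ ω := by
  have : 0 ≤ ∑ t ∈ Finset.range (T + 1), ‖S θ t ω‖ := Finset.sum_nonneg fun _ _ => norm_nonneg _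
  exact inv_pos.2 (by linarith)

theorem weight_le_one (S : ι → ℕ → Ω → EuclideanSpace ℝ (Fin d)) (T : ℕ) (θ : ι) (ω : Ω) :
    weight S T θ ω ≤ 1 := by
  have : 0 ≤ ∑ t ∈ Finset.range (T + 1), ‖S θ t ω‖ := Finset.sum_nonneg fun _ _ => norm_nonneg _
  exact inv_le_one_of_one_le₀ (by linarith)

theorem weight_mul_norm_le_one (S : ι → ℕ → Ω → EuclideanSpace ℝ (Fin d)) {T t : ℕ} (ht : t ≤ T)
    (θ : ι) (ω : Ω) : weight S T θ ω * ‖S θ t ω‖ ≤ 1 := by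
  have h0 : 0 ≤ ∑ t ∈ Finset.range (T + 1), ‖S θ t ω‖ := Finset.sum_nonneg fun _ _ => norm_nonneg _
  have h1 : ‖S θ t ω‖ ≤ ∑ t ∈ Finset.range (T + 1), ‖S θ t ω‖ :=
    Finset.single_le_sum (f := fun t => ‖S θ t ω‖) (fun _ _ => norm_nonneg _)
      (Finset.mem_range.2 (by omega))
  rw [weight, inv_mul_le_iff₀ (by linarith)]
  linarith

theorem measurable_weight {S : ι → ℕ → Ω → EuclideanSpace ℝ (Fin d)}
    (hS : ∀ θ, ∀ t ≤ T, Measurable[F t] (S θ t)) (θ : ι) : Measurable[F T] (weight S T θ) := by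
  refine (measurable_const.add (Finset.measurable_fun_sum _ fun t ht => ?_)).inv
  have htT : t ≤ T := Nat.lt_succ_iff.1 (Finset.mem_range.1 ht)
  exact measurable_norm.comp ((hS θ t htT).mono (F.mono htT) le_rfl)

theorem abs_weight_mul_increment_le (hd : 1 ≤ d) (S : ι → ℕ → Ω → EuclideanSpace ℝ (Fin d))
    {j : ℕ} (hj : j < T * d) (θ : ι) (ω : Ω) :
    |weight S T θ ω * increment hd S j θ ω| ≤ 2 := by
  have hjT : j / d < T := Nat.div_lt_of_lt_mul (by rwa [mul_comm])
  have h1 : |increment hd S j θ ω| ≤ ‖S θ (j / d + 1) ω‖ + ‖S θ (j / d) ω‖ :=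
    (PiLp.norm_apply_le (S θ (j / d + 1) ω - S θ (j / d) ω) ⟨j % d, Nat.mod_lt j hd⟩).trans
      (norm_sub_le _ _)
  rw [abs_mul, abs_of_pos (weight_pos S T θ ω)]
  have h2 := mul_le_mul_of_nonneg_left h1 (weight_pos S T θ ω).le
  have h3 := weight_mul_norm_le_one S (show j / d + 1 ≤ T from hjT) θ ω
  have h4 := weight_mul_norm_le_one S hjT.le θ ω
  rw [mul_add] at h2
  linarith

theorem sum_ite_mul_eq {N j : ℕ} (hj : j < N) (a : ℝ) (X : ℕ → ℝ) :
    ∑ k ∈ Finset.range N, (if k = j then a else 0) * X k = a * X j := by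
  simp only [ite_mul, zero_mul, Finset.sum_ite_eq', Finset.mem_range, hj, if_true]

/-- If nonnegative gains in the models of a countable set `I` vanish, then each event in each model
of `I` is charged by a robust pricing system. -/
theorem exists_isRobustPricingSystem_of_noArbitrage [IsFiniteMeasure P] (hd : 1 ≤ d)
    {S : ι → ℕ → Ω → EuclideanSpace ℝ (Fin d)} (hS : ∀ θ, ∀ t ≤ T, Measurable[F t] (S θ t))
    {I : Set ι} (hI : I.Countable)
    (hNA : ∀ H : ℕ → Ω → EuclideanSpace ℝ (Fin d), IsStrategy F T H →
      (∀ θ ∈ I, ∀ᵐ ω ∂P, 0 ≤ gains H (S θ) T ω) → ∀ θ ∈ I, ∀ᵐ ω ∂P, gains H (S θ) T ω = 0)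
    {θ₀ : ι} (hθ₀ : θ₀ ∈ I) {A : Set Ω} (hA : MeasurableSet[F T] A) (hPA : P A ≠ 0) :
    ∃ Z : DualSpace ι P F T, IsRobustPricingSystem S Z ∧ 0 < ∫ ω in A, density Z θ₀ ω ∂P := by
  classical
  have hNA' : ∀ h : ℕ → Ω → ℝ, (∀ j, Measurable[F (j / d)] (h j)) →
      (∀ θ ∈ I, ∀ᵐ ω ∂P, ∑ j ∈ Finset.range (T * d), h j ω * increment hd S j θ ω ∈ Set.Ici 0) →
      ∀ θ ∈ I, ∀ᵐ ω ∂P, ∑ j ∈ Finset.range (T * d), h j ω * increment hd S j θ ω = 0 := by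
    intro h hh hpos
    simp only [← gains_strategyOf hd S h T] at hpos ⊢
    exact hNA _ (isStrategy_strategyOf hd T hh) hpos
  set w := weight S T with hw
  have hwm : ∀ θ, StronglyMeasurable[F T] (w θ) := fun θ =>
    (measurable_weight hS θ).stronglyMeasurable
  set f : ι → Ω → ℝ := fun θ => if θ = θ₀ then A.indicator (fun _ => 1) else 0 with hf
  have hfm : ∀ θ, StronglyMeasurable[F T] (f θ) := fun θ => by
    simp only [hf]
    split_ifs
    · exact stronglyMeasurable_const.indicator hA
    · exact stronglyMeasurable_zero
  have hf01 : ∀ θ ω, 0 ≤ f θ ω ∧ f θ ω ≤ 1 := fun θ ω => by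
    simp only [hf]
    split_ifs
    · by_cases h : ω ∈ A <;> simp [h]
    · simp
  have hbdd : ∀ {φ : Ω → ℝ} (C : ℝ), StronglyMeasurable[F T] φ → (∀ᵐ ω ∂P, |φ ω| ≤ C) →
      Integrable φ P := fun C hφ hC =>
    (integrable_const C).mono' (hφ.mono (F.le T)).aestronglyMeasurable hC
  have hw1 : ∀ θ ω, |w θ ω| ≤ 1 := fun θ ω => by
    rw [abs_of_pos (weight_pos S T θ ω)]; exact weight_le_one S T θ ω
  obtain ⟨J, Y, hJI, hYm, ⟨C, hYC⟩, hY0, hYf, hYg⟩ := exists_separating_densities P (F.le T) hI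
    isClosed_Ici (Set.mem_Ici.2 le_rfl) (fun x hx y hy => Set.mem_Ici.2 (add_nonneg hx hy))
    (fun a ha x hx => Set.mem_Ici.2 (mul_nonneg ha hx)) (monotone_filtration_div F d) hNA'
    (w := w) (fun θ _ => hwm θ) (fun θ _ => Eventually.of_forall fun ω => weight_pos S T θ ω)
    (f := f) (fun θ _ => hfm θ) (fun θ _ => hbdd 1 ((hwm θ).mul (hfm θ))
      (Eventually.of_forall fun ω => by
        rw [abs_mul, abs_of_nonneg (hf01 θ ω).1]
        exact mul_le_one₀ (hw1 θ ω) (hf01 θ ω).1 (hf01 θ ω).2))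
    (by
      -- Gains dominating `f ≥ 0` vanish by absence of arbitrage, so `f` would vanish, although `A`
      -- is not null.
      rintro ⟨h, hh, hhf⟩
      have h1 := hNA' h hh (fun θ hθ => by
        filter_upwards [hhf θ hθ] with ω h2
        have h3 : 0 ≤ _ - f θ ω := h2
        exact Set.mem_Ici.2 (by linarith [(hf01 θ ω).1])) θ₀ hθ₀
      refine hPA (measure_mono_null ?_ (ae_iff.1 ((hhf θ₀ hθ₀).and h1)))
      rintro ω hω ⟨h2, h3⟩
      rw [h3] at h2
      have h4 : 0 ≤ 0 - f θ₀ ω := h2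
      simp only [hf, if_true, Set.indicator_of_mem hω] at h4
      linarith)
  have hYw : ∀ θ, Integrable (fun ω => Y θ ω * w θ ω) P := fun θ =>
    hbdd C ((hYm θ).mul (hwm θ)) (by
      filter_upwards [hYC θ] with ω h
      rw [abs_mul]
      exact (mul_le_of_le_one_right (abs_nonneg _) (hw1 θ ω)).trans h)
  have hYnn : ∀ θ, ∀ᵐ ω ∂P, 0 ≤ Y θ ω := by
    intro θ
    by_cases hθ : θ ∈ J
    · have hB : MeasurableSet[F T] {ω | Y θ ω < 0} :=
        (hYm θ).measurable measurableSet_Iio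
      set B := {ω | Y θ ω < 0}
      -- The zero strategy dominates `-1_B`, so its price is nonpositive; with `Y < 0` on `B` this
      -- makes `B` null.
      have h1 := hYg (fun _ _ => 0)
        (fun θ' => if θ' = θ then B.indicator (fun _ => -1) else 0)
        (fun _ => measurable_const) (fun θ' _ => by
          split_ifs
          · exact stronglyMeasurable_const.indicator hB
          · exact stronglyMeasurable_zero)
        (fun θ' _ => by
          refine hbdd 1 ((hwm θ').mul ?_) (Eventually.of_forall fun ω => ?_)
          · split_ifs
            · exact stronglyMeasurable_const.indicator hB
            · exact stronglyMeasurable_zero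
          · rw [abs_mul]
            refine mul_le_one₀ (hw1 θ' ω) (abs_nonneg _) ?_
            split_ifs
            · by_cases h : ω ∈ B <;> simp [h]
            · simp)
        (fun θ' _ => Eventually.of_forall fun ω => by
          split_ifs
          · by_cases h : ω ∈ B <;> simp [h]
          · simp)
      rw [Finset.sum_eq_single θ (fun θ' _ h => by simp [h]) (fun h => absurd hθ h)] at h1
      simp only [if_true] at h1
      have hnn : ∀ ω, 0 ≤ Y θ ω * (w θ ω * B.indicator (fun _ => -1) ω) := fun ω => by
        by_cases h : ω ∈ B
        · have h2 : Y θ ω < 0 := h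
          have := weight_pos S T θ ω
          rw [Set.indicator_of_mem h]
          exact mul_nonneg_of_nonpos_of_nonpos h2.le (by linarith)
        · simp [h]
      have h2 := (integral_eq_zero_iff_of_nonneg_ae (Eventually.of_forall hnn)
        (by
          refine ((hYw θ).neg.indicator (F.le T _ hB)).congr (Eventually.of_forall fun ω => ?_)
          by_cases h : ω ∈ B <;> simp [h])).1
        (le_antisymm h1 (integral_nonneg hnn))
      filter_upwards [h2] with ω h3
      by_contra hneg
      have h4 : ω ∈ B := not_le.1 hneg
      simp only [Pi.zero_apply, Set.indicator_of_mem h4] at h3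
      have h5 : Y θ ω < 0 := h4
      have h6 : w θ ω ≠ 0 := (weight_pos S T θ ω).ne'
      simp [h5.ne, h6] at h3
    · simp [hY0 θ hθ]
  set c := ∑ θ ∈ J, ∫ ω, Y θ ω * w θ ω ∂P with hc
  have hcpos : 0 < c := by
    refine hYf.trans_le (Finset.sum_le_sum fun θ _ => integral_mono_of_nonneg ?_ (hYw θ) ?_)
    · filter_upwards [hYnn θ] with ω h
      exact mul_nonneg h (mul_nonneg (weight_pos S T θ ω).le (hf01 θ ω).1)
    · filter_upwards [hYnn θ] with ω h
      exact mul_le_mul_of_nonneg_left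
        (mul_le_of_le_one_right (weight_pos S T θ ω).le (hf01 θ ω).2) h
  have hYinc : ∀ j < T * d, ∀ B, MeasurableSet[F (j / d)] B →
      ∑ θ ∈ J, ∫ ω in B, Y θ ω * (w θ ω * increment hd S j θ ω) ∂P = 0 := by
    intro j hj B hB
    have hjT : j / d < T := Nat.div_lt_of_lt_mul (by rwa [mul_comm])
    have hBT : MeasurableSet[F T] B := F.mono hjT.le _ hB
    -- Buying and selling the increment on `B` are both attainable exactly, so `a = 1` and `a = -1`
    -- give equality.
    have key : ∀ a : ℝ, a * ∑ θ ∈ J, ∫ ω in B, Y θ ω * (w θ ω * increment hd S j θ ω) ∂P ≤ 0 := by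
      intro a
      have hBa : StronglyMeasurable[F (j / d)] (B.indicator fun _ => a) :=
        stronglyMeasurable_const.indicator hB
      have hm : ∀ θ, StronglyMeasurable[F T]
          fun ω => B.indicator (fun _ => a) ω * increment hd S j θ ω := fun θ =>
        (hBa.mono (F.mono hjT.le)).mul (measurable_increment hd hS hj θ).stronglyMeasurable
      have h1 := hYg (fun k => if k = j then B.indicator (fun _ => a) else 0)
        (fun θ ω => B.indicator (fun _ => a) ω * increment hd S j θ ω)
        (fun k => by
          by_cases hk : k = j
          · subst hk
            simp only [if_true]
            exact hBa.measurable
          · simp only [hk, if_false]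
            exact measurable_const)
        (fun θ _ => hm θ)
        (fun θ _ => by
          refine hbdd (|a| * 2) ((hwm θ).mul (hm θ)) (Eventually.of_forall fun ω => ?_)
          rw [mul_left_comm, abs_mul]
          refine mul_le_mul ?_ (abs_weight_mul_increment_le hd S hj θ ω) (abs_nonneg _)
            (abs_nonneg _)
          by_cases h : ω ∈ B <;> simp [h])
        (fun θ _ => Eventually.of_forall fun ω => by
          have h2 := sum_ite_mul_eq hj (B.indicator (fun _ => a) ω)
            (fun k => increment hd S k θ ω)
          rw [← h2, Set.mem_Ici, ← Finset.sum_sub_distrib]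
          refine (Finset.sum_eq_zero fun k _ => ?_).ge
          by_cases hk : k = j <;> simp [hk])
      refine le_trans (le_of_eq ?_) h1
      rw [Finset.mul_sum]
      refine Finset.sum_congr rfl fun θ _ => ?_
      rw [← integral_const_mul, ← integral_indicator (F.le T _ hBT)]
      refine integral_congr_ae (Eventually.of_forall fun ω => ?_)
      by_cases h : ω ∈ B
      · simp only [Set.indicator_of_mem h]; ring
      · simp [h]
    have h1 := key 1
    have h2 := key (-1)
    linarith
  -- The weight is part of the density: it keeps `z * S` bounded, hence integrable. The factor `c⁻¹`
  -- gives total mass one.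
  obtain ⟨Z, hZ, hZz⟩ := exists_isRobustPricingSystem (P := P) (F := F) (T := T) hd hS J
    (z := fun θ ω => c⁻¹ * (Y θ ω * w θ ω))
    (fun θ => (stronglyMeasurable_const.mul ((hYm θ).mul (hwm θ))).aestronglyMeasurable)
    (fun θ => ⟨c⁻¹ * C, by
      filter_upwards [hYC θ] with ω h
      rw [abs_mul, abs_mul, abs_of_pos (inv_pos.2 hcpos)]
      exact mul_le_mul_of_nonneg_left
        ((mul_le_of_le_one_right (abs_nonneg _) (hw1 θ ω)).trans h) (inv_pos.2 hcpos).le⟩)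
    (fun θ hθ => by simp [hY0 θ hθ]; rfl)
    (fun θ => by
      filter_upwards [hYnn θ] with ω h
      exact mul_nonneg (inv_pos.2 hcpos).le (mul_nonneg h (weight_pos S T θ ω).le))
    (by
      simp only [integral_const_mul]
      rw [← Finset.mul_sum, inv_mul_cancel₀ hcpos.ne'])
    (fun θ t ht => by
      refine (integrable_const (c⁻¹ * C)).mono' ?_ ?_
      · exact ((stronglyMeasurable_const.mul ((hYm θ).mul (hwm θ))).mono
          (F.le T)).aestronglyMeasurable.smul
          ((hS θ t ht).stronglyMeasurable.mono (F.le t)).aestronglyMeasurable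
      · filter_upwards [hYC θ] with ω h
        rw [norm_smul, norm_mul, norm_mul, Real.norm_eq_abs, abs_of_pos (inv_pos.2 hcpos),
          mul_assoc, mul_assoc, Real.norm_eq_abs, Real.norm_eq_abs,
          abs_of_pos (weight_pos S T θ ω)]
        refine mul_le_mul_of_nonneg_left ?_ (inv_pos.2 hcpos).le
        exact (mul_le_of_le_one_right (abs_nonneg _) (weight_mul_norm_le_one S ht θ ω)).trans h)
    (fun j hj B hB => by
      simp only [mul_assoc, integral_const_mul]
      rw [← Finset.mul_sum, hYinc j hj B hB, mul_zero])
  refine ⟨Z, hZ, ?_⟩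
  have hA' := F.le T _ hA
  have hθ₀J : θ₀ ∈ J := by
    by_contra h
    refine hYf.ne' (Finset.sum_eq_zero fun θ hθ => ?_)
    have : θ ≠ θ₀ := fun h' => h (h' ▸ hθ)
    simp [hf, this]
  rw [Finset.sum_eq_single θ₀ (fun θ _ h => by simp [hf, h]) (fun h => absurd hθ₀J h)] at hYf
  rw [setIntegral_congr_ae (g := fun ω => c⁻¹ * (Y θ₀ ω * w θ₀ ω)) hA'
    (by filter_upwards [hZz θ₀] with ω h _ using h), integral_const_mul]
  refine mul_pos (inv_pos.2 hcpos) (hYf.trans_eq ?_)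
  rw [← integral_indicator hA']
  refine integral_congr_ae (Eventually.of_forall fun ω => ?_)
  by_cases h : ω ∈ A <;> simp [hf, h]

end Existence

/-! ### Completeness and uniqueness of the pricing system -/

section Completeness

variable {ι Ω : Type*} {mΩ : MeasurableSpace Ω} {P : Measure Ω} {F : Filtration ℕ mΩ} {T d : ℕ}

/-- The claim that pays `1` on the event `A` in the model `θ` and nothing in other models. -/
noncomputable def modelClaim (θ : ι) (A : Set Ω) (θ' : ι) : Ω → ℝ :=
  open Classical in if θ' = θ then A.indicator fun _ => 1 else fun _ => 0

theorem isContingentClaim_modelClaim (θ : ι) {A : Set Ω} (hA : MeasurableSet[F T] A) :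
    IsContingentClaim P F T (modelClaim θ A) := by
  intro θ'
  by_cases h : θ' = θ
  · simp only [modelClaim, h, if_true]
    exact ⟨measurable_const.indicator hA,
      Eventually.of_forall fun ω => Set.indicator_nonneg (fun _ _ => zero_le_one) ω⟩
  · simp only [modelClaim, h, if_false]
    exact ⟨measurable_const, Eventually.of_forall fun _ => le_rfl⟩

theorem pricing_modelClaim (Z : DualSpace ι P F T) (θ : ι) {A : Set Ω}
    (hA : MeasurableSet[F T] A) :
    pricing Z (modelClaim θ A) = ∫ ω in A, density Z θ ω ∂P := by
  classical
  rw [pricing_eq_sum (Finset.subset_insert θ Z.support),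
    Finset.sum_eq_single θ (fun θ' _ h => by simp [modelClaim, h]) (by simp),
    ← integral_indicator (F.le T _ hA)]
  refine integral_congr_ae (Eventually.of_forall fun ω => ?_)
  by_cases h : ω ∈ A <;> simp [modelClaim, h]

theorem DualSpace.ext_of_setIntegral [IsFiniteMeasure P] {Z Z' : DualSpace ι P F T}
    (h : ∀ θ, ∀ A, MeasurableSet[F T] A →
      ∫ ω in A, density Z θ ω ∂P = ∫ ω in A, density Z' θ ω ∂P) : Z = Z' := by
  refine Finsupp.ext fun θ => Subtype.ext (Lp.ext ?_)
  exact ae_eq_of_forall_setIntegral_eq_of_sigmaFinite' (F.le T)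
    (fun _ _ _ => (integrable_density Z θ).integrableOn)
    (fun _ _ _ => (integrable_density Z' θ).integrableOn) (fun A hA _ => h θ A hA)
    (aestronglyMeasurable_density Z θ) (aestronglyMeasurable_density Z' θ)

/-- In a complete market there is at most one robust pricing system. -/
theorem IsComplete.pricingSystem_unique [IsFiniteMeasure P] (hd : 1 ≤ d)
    {S : ι → ℕ → Ω → EuclideanSpace ℝ (Fin d)} (hcomp : IsComplete P F T S)
    {Z Z' : DualSpace ι P F T} (hZ : IsRobustPricingSystem S Z)
    (hZ' : IsRobustPricingSystem S Z') : Z = Z' := by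
  refine DualSpace.ext_of_setIntegral fun θ A hA => ?_
  have hclaim := isContingentClaim_modelClaim (P := P) θ hA
  obtain ⟨x, H, hH, hx⟩ := hcomp _ hclaim
  rw [← pricing_modelClaim Z θ hA, ← pricing_modelClaim Z' θ hA,
    hZ.pricing_eq_of_replicates hd (fun θ' => (hclaim θ').2) hH hx,
    hZ'.pricing_eq_of_replicates hd (fun θ' => (hclaim θ').2) hH hx]

/-- The initial capital is treated as an extra asset with constant payoff `1` at index `0`; its
σ-algebra `⊥` forces the position to be constant. -/
theorem monotone_seqCons_filtration (F : Filtration ℕ mΩ) (d : ℕ) :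
    Monotone (seqCons ⊥ fun j => F (j / d)) := by
  refine monotone_nat_of_le_succ fun n => ?_
  cases n with
  | zero => exact bot_le
  | succ n => exact monotone_filtration_div F d (Nat.le_succ n)

/-- A constant position and real-valued positions in the increments yield a replicating
strategy. -/
theorem isReplicable_of_portfolio (hd : 1 ≤ d) {S : ι → ℕ → Ω → EuclideanSpace ℝ (Fin d)}
    {f : ι → Ω → ℝ} {h : ℕ → Ω → ℝ}
    (hh : ∀ j, Measurable[(seqCons ⊥ fun j => F (j / d) : ℕ → MeasurableSpace Ω) j] (h j))
    (hf : ∀ θ, ∀ᵐ ω ∂P, ∑ j ∈ Finset.range (T * d + 1), h j ω *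
      (seqCons (fun _ _ => 1) (increment hd S) : ℕ → ι → Ω → ℝ) j θ ω = f θ ω) :
    IsReplicable P F T S f := by
  obtain ⟨x, hx⟩ := stronglyMeasurable_bot_iff.1
    (show Measurable[⊥] (h 0) from hh 0).stronglyMeasurable
  refine ⟨x, strategyOf d fun j => h (j + 1), isStrategy_strategyOf hd T fun j => hh (j + 1),
    fun θ => ?_⟩
  filter_upwards [hf θ] with ω h1
  rw [gains_strategyOf hd, ← h1, Finset.sum_range_succ', hx]
  simp [seqCons, add_comm]

/-- If a robust pricing system charging all models is unique, then the claims which are integrable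
with respect to it are replicable. -/
theorem exists_portfolio_of_unique [IsFiniteMeasure P] (hd : 1 ≤ d)
    {S : ι → ℕ → Ω → EuclideanSpace ℝ (Fin d)} (hS : ∀ θ, ∀ t ≤ T, Measurable[F t] (S θ t))
    {Z : DualSpace ι P F T} (hZ : IsRobustPricingSystem S Z)
    (huniq : ∀ Z' : DualSpace ι P F T, IsRobustPricingSystem S Z' → Z' = Z)
    (hpos : ∀ θ, ∀ᵐ ω ∂P, 0 < density Z θ ω) (hsupp : ∀ θ, θ ∈ Z.support)
    {f : ι → Ω → ℝ} (hfm : ∀ θ, Measurable[F T] (f θ))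
    (hfi : ∀ θ, Integrable (fun ω => density Z θ ω * f θ ω) P) :
    ∃ h : ℕ → Ω → ℝ,
      (∀ j, Measurable[(seqCons ⊥ fun j => F (j / d) : ℕ → MeasurableSpace Ω) j] (h j)) ∧
      ∀ θ, ∀ᵐ ω ∂P, ∑ j ∈ Finset.range (T * d + 1), h j ω *
        (seqCons (fun _ _ => 1) (increment hd S) : ℕ → ι → Ω → ℝ) j θ ω = f θ ω := by
  classical
  by_contra hcon
  set X : ℕ → ι → Ω → ℝ := seqCons (fun _ _ => 1) (increment hd S) with hX
  set w : ι → Ω → ℝ := fun θ => (aestronglyMeasurable_density Z θ).mk _ with hw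
  have hwm : ∀ θ, StronglyMeasurable[F T] (w θ) := fun θ =>
    (aestronglyMeasurable_density Z θ).stronglyMeasurable_mk
  have hwZ : ∀ θ, density Z θ =ᵐ[P] w θ := fun θ => (aestronglyMeasurable_density Z θ).ae_eq_mk
  have hwpos : ∀ θ, ∀ᵐ ω ∂P, 0 < w θ ω := fun θ => by
    filter_upwards [hpos θ, hwZ θ] with ω h1 h2
    rwa [← h2]
  have hwint : ∀ θ, Integrable (w θ) P := fun θ => (integrable_density Z θ).congr (hwZ θ)
  have hwinc : ∀ j < T * d, ∀ θ, Integrable (fun ω => w θ ω * increment hd S j θ ω) P :=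
    fun j hj θ => (hZ.integrable_increment hd hj θ).congr (by
      filter_upwards [hwZ θ] with ω h; rw [h])
  -- With `ρ = {0}` attainability is exact and the no-arbitrage hypothesis is a tautology.
  obtain ⟨J, Y, -, hYm, ⟨C, hYC⟩, hY0, hYf, hYg⟩ := exists_separating_densities P (F.le T)
    (I := Set.univ) (Z.support.countable_toSet.mono fun θ _ => hsupp θ)
    (ρ := {0}) isClosed_singleton rfl
    (fun x hx y hy => by simp_all) (fun a _ x hx => by simp_all) (N := T * d + 1)
    (monotone_seqCons_filtration F d) (X := X)
    (fun h _ h0 => h0) (w := w) (fun θ _ => hwm θ) (fun θ _ => hwpos θ) (f := f)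
    (fun θ _ => (hfm θ).stronglyMeasurable)
    (fun θ _ => (hfi θ).congr (by filter_upwards [hwZ θ] with ω h; rw [h]))
    (by
      rintro ⟨h, hh, hhf⟩
      refine hcon ⟨h, hh, fun θ => ?_⟩
      filter_upwards [hhf θ (Set.mem_univ θ)] with ω h1
      exact sub_eq_zero.1 h1)
  have hYw : ∀ θ, ∀ φ : Ω → ℝ, Integrable (fun ω => w θ ω * φ ω) P →
      Integrable (fun ω => Y θ ω * (w θ ω * φ ω)) P := fun θ φ hφ =>
    hφ.bdd_mul ((hYm θ).mono (F.le T)).aestronglyMeasurable (hYC θ)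
  -- the separating densities annihilate constants and increments
  have hY1 : ∑ θ ∈ J, ∫ ω, Y θ ω * w θ ω ∂P = 0 := by
    have key : ∀ a : ℝ, a * ∑ θ ∈ J, ∫ ω, Y θ ω * w θ ω ∂P ≤ 0 := by
      intro a
      have h1 := hYg (fun k => if k = 0 then fun _ => a else 0) (fun _ _ => a)
        (fun k => by
          by_cases hk : k = 0
          · subst hk
            exact measurable_const
          · simp only [hk, if_false]
            exact measurable_const)
        (fun θ _ => stronglyMeasurable_const) (fun θ _ => (hwint θ).mul_const a)
        (fun θ _ => Eventually.of_forall fun ω => by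
          rw [Finset.sum_range_succ']
          simp [hX, seqCons])
      refine le_trans (le_of_eq ?_) h1
      rw [Finset.mul_sum]
      refine Finset.sum_congr rfl fun θ _ => ?_
      rw [← integral_const_mul]
      exact integral_congr_ae (Eventually.of_forall fun ω => by simp only; ring)
    have h1 := key 1
    have h2 := key (-1)
    linarith
  have hYinc : ∀ j < T * d, ∀ B, MeasurableSet[F (j / d)] B →
      ∑ θ ∈ J, ∫ ω in B, Y θ ω * (w θ ω * increment hd S j θ ω) ∂P = 0 := by
    intro j hj B hB
    have hjT : j / d < T := Nat.div_lt_of_lt_mul (by rwa [mul_comm])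
    have hBT : MeasurableSet[F T] B := F.mono hjT.le _ hB
    have key : ∀ a : ℝ, a * ∑ θ ∈ J, ∫ ω in B, Y θ ω * (w θ ω * increment hd S j θ ω) ∂P ≤ 0 := by
      intro a
      have hBa : StronglyMeasurable[F (j / d)] (B.indicator fun _ => a) :=
        stronglyMeasurable_const.indicator hB
      have h1 := hYg (fun k => if k = j + 1 then B.indicator (fun _ => a) else 0)
        (fun θ ω => B.indicator (fun _ => a) ω * increment hd S j θ ω)
        (fun k => by
          by_cases hk : k = j + 1
          · subst hk
            simp only [if_true]
            exact hBa.measurable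
          · simp only [hk, if_false]
            exact measurable_const)
        (fun θ _ => (hBa.mono (F.mono hjT.le)).mul
          (measurable_increment hd hS hj θ).stronglyMeasurable)
        (fun θ _ => by
          refine (((hwinc j hj θ).indicator (F.le T _ hBT)).const_mul a).congr
            (Eventually.of_forall fun ω => ?_)
          by_cases h : ω ∈ B
          · simp only [Set.indicator_of_mem h]; ring
          · simp [h])
        (fun θ _ => Eventually.of_forall fun ω => by
          have h2 := sum_ite_mul_eq (Nat.succ_lt_succ hj) (B.indicator (fun _ => a) ω)
            (fun k => X k θ ω)
          have h3 : X (j + 1) θ ω = increment hd S j θ ω := rfl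
          rw [Nat.succ_eq_add_one, h3, Nat.succ_eq_add_one] at h2
          rw [← h2, Set.mem_singleton_iff, ← Finset.sum_sub_distrib]
          refine Finset.sum_eq_zero fun k _ => ?_
          by_cases hk : k = j + 1 <;> simp [hk])
      refine le_trans (le_of_eq ?_) h1
      rw [Finset.mul_sum]
      refine Finset.sum_congr rfl fun θ _ => ?_
      rw [← integral_const_mul, ← integral_indicator (F.le T _ hBT)]
      refine integral_congr_ae (Eventually.of_forall fun ω => ?_)
      by_cases h : ω ∈ B
      · simp only [Set.indicator_of_mem h]; ring
      · simp [h]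
    have h1 := key 1
    have h2 := key (-1)
    linarith
  -- sums over `J` extend to all models
  have hext : ∀ (μ : Measure Ω) (φ : ι → Ω → ℝ), ∑ θ ∈ Z.support, ∫ ω, Y θ ω * φ θ ω ∂μ =
      ∑ θ ∈ J, ∫ ω, Y θ ω * φ θ ω ∂μ := fun μ φ =>
    (Finset.sum_subset (fun θ _ => hsupp θ) fun θ _ hθ => by simp [hY0 θ hθ]).symm
  -- Small enough that `1 + ε Y` lies between `0` and `2`, so the perturbed densities are
  -- nonnegative and bounded.
  set ε : ℝ := (|C| + 1)⁻¹ with hε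
  have hεpos : 0 < ε := by positivity
  have hεY : ∀ θ, ∀ᵐ ω ∂P, |ε * Y θ ω| ≤ 1 := fun θ => by
    filter_upwards [hYC θ] with ω h
    rw [abs_mul, abs_of_pos hεpos, hε, inv_mul_le_iff₀ (by positivity)]
    linarith [le_abs_self C]
  obtain ⟨Z', hZ', hZz⟩ := exists_isRobustPricingSystem (P := P) (F := F) (T := T) hd hS Z.support
    (z := fun θ ω => (1 + ε * Y θ ω) * w θ ω)
    (fun θ => ((stronglyMeasurable_const.add (stronglyMeasurable_const.mul (hYm θ))).mul
      (hwm θ)).aestronglyMeasurable)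
    (fun θ => by
      refine ⟨2 * (eLpNorm (density Z θ) ⊤ P).toReal, ?_⟩
      have hb := ae_le_eLpNormEssSup (μ := P) (f := density Z θ)
      filter_upwards [hb, hwZ θ, hεY θ] with ω h1 h2 h3
      rw [← h2, abs_mul]
      refine mul_le_mul ?_ ?_ (abs_nonneg _) zero_le_two
      · exact (abs_add_le _ _).trans (by rw [abs_one]; linarith)
      · have h4 := ENNReal.toReal_mono (memLp_density Z θ).2.ne h1
        simpa using h4)
    (fun θ hθ => absurd (hsupp θ) hθ)
    (fun θ => by
      filter_upwards [hεY θ, hwpos θ] with ω h1 h2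
      exact mul_nonneg (by linarith [(abs_le.1 h1).1]) h2.le)
    (by
      have h1 : ∀ θ ∈ Z.support, ∫ ω, (1 + ε * Y θ ω) * w θ ω ∂P =
          ∫ ω, density Z θ ω ∂P + ε * ∫ ω, Y θ ω * w θ ω ∂P := fun θ _ => by
        rw [← integral_const_mul, ← integral_add (integrable_density Z θ)
          ((by simpa using hYw θ (fun _ => 1) (by simpa using hwint θ) :
            Integrable (fun ω => Y θ ω * w θ ω) P).const_mul ε)]
        refine integral_congr_ae ?_
        filter_upwards [hwZ θ] with ω h
        rw [h]; ring
      rw [Finset.sum_congr rfl h1, Finset.sum_add_distrib, hZ.sum_integral_density,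
        ← Finset.mul_sum, hext, hY1, mul_zero, add_zero])
    (fun θ t ht => by
      have h1 := (hZ.martingale.integrable_density θ t ht).bdd_smul 2
        (φ := fun ω => 1 + ε * Y θ ω)
        ((stronglyMeasurable_const.add (stronglyMeasurable_const.mul (hYm θ))).mono
          (F.le T)).aestronglyMeasurable (by
          filter_upwards [hεY θ] with ω h3
          exact (abs_add_le _ _).trans (by rw [abs_one]; linarith))
      refine h1.congr ?_
      filter_upwards [hwZ θ] with ω h
      simp only [Pi.smul_apply', smul_smul]
      rw [h])
    (fun j hj B hB => by
      have h1 : ∀ θ ∈ Z.support, ∫ ω in B, (1 + ε * Y θ ω) * w θ ω * increment hd S j θ ω ∂P =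
          ∫ ω in B, density Z θ ω * increment hd S j θ ω ∂P +
            ε * ∫ ω in B, Y θ ω * (w θ ω * increment hd S j θ ω) ∂P := fun θ _ => by
        rw [← integral_const_mul, ← integral_add (hZ.integrable_increment hd hj θ).integrableOn
          ((hYw θ _ (hwinc j hj θ)).integrableOn.const_mul ε)]
        refine integral_congr_ae (ae_restrict_of_ae ?_)
        filter_upwards [hwZ θ] with ω h
        rw [h]; ring
      rw [Finset.sum_congr rfl h1, Finset.sum_add_distrib, hZ.sum_setIntegral_increment hd hj hB,
        ← Finset.mul_sum, hext, hYinc j hj B hB, mul_zero, add_zero])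
  -- Uniqueness gives `(1 + ε Y) w = w` with `w > 0`, so `Y = 0`, while `Y` was to have a positive
  -- value at `f`.
  refine hYf.ne' (Finset.sum_eq_zero fun θ _ => integral_eq_zero_of_ae ?_)
  have h1 := hZz θ
  rw [huniq Z' hZ'] at h1
  filter_upwards [h1, hwZ θ, hwpos θ] with ω h2 h3 h4
  rw [h3] at h2
  have h5 : ε * Y θ ω * w θ ω = 0 := by linarith
  have h6 : Y θ ω = 0 := by
    simpa [hεpos.ne', h4.ne'] using h5
  simp [h6]

/-- If a robust pricing system charging all models is unique, then the market is complete. -/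
theorem isComplete_of_unique [IsFiniteMeasure P] (hd : 1 ≤ d)
    {S : ι → ℕ → Ω → EuclideanSpace ℝ (Fin d)} (hS : ∀ θ, ∀ t ≤ T, Measurable[F t] (S θ t))
    {Z : DualSpace ι P F T} (hZ : IsRobustPricingSystem S Z)
    (huniq : ∀ Z' : DualSpace ι P F T, IsRobustPricingSystem S Z' → Z' = Z)
    (hpos : ∀ θ, ∀ᵐ ω ∂P, 0 < density Z θ ω) (hsupp : ∀ θ, θ ∈ Z.support) :
    IsComplete P F T S := by
  intro f hf
  -- A claim need not be integrable under `Z`. Its bounded truncations are, and at each point they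
  -- eventually equal the claim.
  set g : ℕ → ι → Ω → ℝ := fun n θ ω => max (min (f θ ω) n) (-n) with hg
  have hgm : ∀ n θ, Measurable[F T] (g n θ) := fun n θ =>
    ((hf θ).1.min measurable_const).max measurable_const
  have hgb : ∀ n θ ω, |g n θ ω| ≤ n := fun n θ ω => by
    have : (0 : ℝ) ≤ n := n.cast_nonneg
    exact abs_le.2 ⟨le_max_right _ _, max_le (min_le_right _ _) (by linarith)⟩
  choose h hh hhg using fun n => exists_portfolio_of_unique hd hS hZ huniq hpos hsupp (hgm n)
    (fun θ => (integrable_density Z θ).mul_bdd (c := n)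
      ((hgm n θ).stronglyMeasurable.mono (F.le T)).aestronglyMeasurable
      (Eventually.of_forall (hgb n θ)))
  obtain ⟨h', hh', hhf⟩ := exists_portfolio_of_tendsto P Set.univ (ρ := {0}) isClosed_singleton
    (fun a _ x hx => by simp_all) (T * d + 1) _ (monotone_seqCons_filtration F d)
    (seqCons (fun _ _ => 1) (increment hd S)) (fun _ _ h0 => h0) h (fun _ _ _ => 0) f hh
    (fun _ _ => Eventually.of_forall fun _ _ => rfl)
    (fun θ _ => by
      filter_upwards [ae_all_iff.2 fun n => hhg n θ] with ω h1
      refine tendsto_const_nhds.congr' ?_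
      obtain ⟨n, hn⟩ := exists_nat_ge |f θ ω|
      filter_upwards [eventually_ge_atTop n] with k hk
      have hk' : |f θ ω| ≤ k := hn.trans (Nat.cast_le.2 hk)
      rw [h1, sub_zero]
      simp only [hg]
      rw [min_eq_left (abs_le.1 hk').2, max_eq_left (abs_le.1 hk').1])
  refine isReplicable_of_portfolio hd hh' fun θ => ?_
  filter_upwards [hhf θ (Set.mem_univ θ)] with ω h1
  exact sub_eq_zero.1 h1

theorem mem_pricingSystems_iff {S : ι → ℕ → Ω → EuclideanSpace ℝ (Fin d)}
    {Z : DualSpace ι P F T} : Z ∈ pricingSystems P F T S ↔ IsRobustPricingSystem S Z := by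
  refine ⟨fun h => ?_, fun h => ?_⟩
  · obtain ⟨θ, hθ⟩ := Set.mem_iUnion.1 h
    exact hθ.1
  · obtain ⟨θ, A, -, hA⟩ := h.pos
    refine Set.mem_iUnion.2 ⟨θ, h, fun h0 => hA.ne' ?_⟩
    refine integral_eq_zero_of_ae (ae_restrict_of_ae ?_)
    exact density_eq_zero_of_notMem (Finsupp.notMem_support_iff.2 h0)

/-- A unique robust pricing system is equivalent to the reference measure in each model if each
event in each model is charged by a robust pricing system. -/
theorem density_pos_of_unique {S : ι → ℕ → Ω → EuclideanSpace ℝ (Fin d)}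
    (hex : ∀ θ, ∀ A, MeasurableSet[F T] A → P A ≠ 0 →
      ∃ Z : DualSpace ι P F T, IsRobustPricingSystem S Z ∧ 0 < ∫ ω in A, density Z θ ω ∂P)
    {Z : DualSpace ι P F T} (huniq : ∀ Z' : DualSpace ι P F T, IsRobustPricingSystem S Z' → Z' = Z)
    (θ : ι) : ∀ᵐ ω ∂P, 0 < density Z θ ω := by
  have hm := aestronglyMeasurable_density Z θ
  have hB : MeasurableSet[F T] {ω | hm.mk _ ω ≤ 0} :=
    hm.stronglyMeasurable_mk.measurable measurableSet_Iic
  have hP : P {ω | hm.mk _ ω ≤ 0} = 0 := by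
    by_contra hne
    obtain ⟨Z', hZ', hpos⟩ := hex θ _ hB hne
    rw [huniq Z' hZ', setIntegral_congr_ae (g := hm.mk _) (F.le T _ hB)
      (by filter_upwards [hm.ae_eq_mk] with ω h _ using h)] at hpos
    exact absurd (setIntegral_nonpos (F.le T _ hB) fun ω hω => hω) (not_le.2 hpos)
  have : ∀ᵐ ω ∂P, ¬ hm.mk _ ω ≤ 0 := ae_iff.2 (by simpa using hP)
  filter_upwards [this, hm.ae_eq_mk] with ω h1 h2
  rw [h2]
  exact not_le.1 h1

theorem mem_support_of_density_pos [NeZero P] {Z : DualSpace ι P F T} {θ : ι}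
    (h : ∀ᵐ ω ∂P, 0 < density Z θ ω) : θ ∈ Z.support := by
  by_contra hθ
  have h1 : ∀ᵐ ω ∂P, False := by
    filter_upwards [h, density_eq_zero_of_notMem hθ] with ω h2 h3
    rw [h3] at h2
    exact lt_irrefl _ h2
  exact h1.exists.elim fun _ hf => hf

theorem gains_neg (H Y : ℕ → Ω → EuclideanSpace ℝ (Fin d)) (t : ℕ) (ω : Ω) :
    gains (fun s ω => -H s ω) Y t ω = -gains H Y t ω := by
  simp [gains, inner_neg_left]

/-- A complete market with a pricing density which is positive in each model has just one model if
one of its models is free of classical arbitrage. -/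
theorem IsComplete.eq_of_noArbitrage [IsProbabilityMeasure P] (hd : 1 ≤ d)
    {S : ι → ℕ → Ω → EuclideanSpace ℝ (Fin d)} (hcomp : IsComplete P F T S)
    {Z : DualSpace ι P F T} (hZ : IsRobustPricingSystem S Z)
    (hpos : ∀ θ, ∀ᵐ ω ∂P, 0 < density Z θ ω) {θ : ι} (hNA : NoArbitrage P F T (S θ)) (θ' : ι) :
    θ' = θ := by
  by_contra hne
  -- This claim has a positive price because `Z` charges `θ'`, yet it pays nothing in `θ`: there the
  -- opposite strategy earns exactly `x`.
  have hclaim := isContingentClaim_modelClaim (P := P) (F := F) (T := T) θ' MeasurableSet.univ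
  obtain ⟨x, H, hH, hx⟩ := hcomp _ hclaim
  have hxpos : 0 < x := by
    rw [← hZ.pricing_eq_of_replicates hd (fun θ' => (hclaim θ').2) hH hx,
      pricing_modelClaim Z θ' MeasurableSet.univ, setIntegral_univ,
      integral_pos_iff_support_of_nonneg_ae (by filter_upwards [hpos θ'] with ω h using h.le)
        (integrable_density Z θ')]
    refine pos_iff_ne_zero.2 fun h0 => ?_
    have h1 : ∀ᵐ ω ∂P, False := by
      filter_upwards [hpos θ', measure_eq_zero_iff_ae_notMem.1 h0] with ω h2 h3
      exact h3 h2.ne'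
    exact h1.exists.elim fun _ hf => hf
  have hg : ∀ᵐ ω ∂P, gains (fun s ω => -H s ω) (S θ) T ω = x := by
    filter_upwards [hx θ] with ω h
    rw [gains_neg]
    simp only [modelClaim, Ne.symm hne, if_false] at h
    linarith
  have h0 := hNA _ (fun t ht => (hH t ht).neg) (by
    filter_upwards [hg] with ω h
    exact h.symm ▸ hxpos.le)
  have h1 : ∀ᵐ ω ∂P, False := by
    filter_upwards [hg, h0] with ω h2 h3
    exact hxpos.ne' (h2.symm.trans h3)
  exact h1.exists.elim fun _ hf => hf

theorem tendsto_gains {H : ℕ → Ω → EuclideanSpace ℝ (Fin d)}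
    {Y : ℕ → ℕ → Ω → EuclideanSpace ℝ (Fin d)} {Y' : ℕ → Ω → EuclideanSpace ℝ (Fin d)} {ω : Ω}
    (h : ∀ t ≤ T, Tendsto (fun k => Y k t ω) atTop (𝓝 (Y' t ω))) :
    Tendsto (fun k => gains H (Y k) T ω) atTop (𝓝 (gains H Y' T ω)) := by
  refine tendsto_finsetSum _ fun t ht => ?_
  have htT := Finset.mem_range.1 ht
  exact tendsto_const_nhds.inner ((h (t + 1) htT).sub (h t htT.le))

end Completeness

end RobustMarket

/-! ### The theorem -/

theorem mainTheorem5
    {Ω X : Type*} {mΩ : MeasurableSpace Ω} (P : Measure Ω) [IsProbabilityMeasure P]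
    (F : Filtration ℕ mΩ) (T d : ℕ) (hd : 1 ≤ d)
    (hF : ∀ A : Set Ω, MeasurableSet A → P A = 0 → MeasurableSet[F 0] A)
    [MetricSpace X] [TopologicalSpace.SeparableSpace X]
    (Θ : Set X) (hΘ : IsClosed Θ) (hne : Θ.Nonempty)
    (S : Θ → ℕ → Ω → EuclideanSpace ℝ (Fin d))
    (hS : ∀ θ, ∀ t ≤ T, Measurable[F t] (S θ t))
    (hS0 : ∀ θ, ∀ᵐ ω ∂P, ∀ i, S θ 0 ω i = 1)
    (hcont : ∀ (u : ℕ → Θ) (θ : Θ), Tendsto u atTop (𝓝 θ) →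
      ∃ φ : ℕ → ℕ, StrictMono φ ∧
        ∀ t ≤ T, ∀ᵐ ω ∂P, Tendsto (fun k => S (u (φ k)) t ω) atTop (𝓝 (S θ t ω)))
    (hNRA : RobustMarket.NoRobustArbitrage P F T S) :
    (RobustMarket.IsComplete P F T S ↔ (RobustMarket.pricingSystems P F T S).encard = 1) ∧
    (RobustMarket.IsComplete P F T S → Θ.Finite) ∧
    (RobustMarket.IsComplete P F T S →
      ∀ θ : Θ, RobustMarket.NoArbitrage P F T (S θ) → Θ = {(θ : X)}) := by
  open RobustMarket in
  have hex : ∀ θ, ∀ A, MeasurableSet[F T] A → P A ≠ 0 → ∃ Z : DualSpace Θ P F T,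
      IsRobustPricingSystem S Z ∧ 0 < ∫ ω in A, density Z θ ω ∂P := by
    intro θ A hA hPA
    have : SecondCountableTopology X := UniformSpace.secondCountable_of_separable X
    obtain ⟨D, hDc, hDd⟩ := TopologicalSpace.exists_countable_dense Θ
    refine exists_isRobustPricingSystem_of_noArbitrage hd hS (hDc.insert θ)
      (fun H hH hpos => ?_) (Set.mem_insert θ D) hA hPA
    -- Nonnegativity passes from the dense models to any `θ'` along an almost surely convergent
    -- subsequence, so NRA applies to the countable set.
    have hall : ∀ θ, ∀ᵐ ω ∂P, 0 ≤ gains H (S θ) T ω := by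
      intro θ'
      obtain ⟨u, huD, hu⟩ := mem_closure_iff_seq_limit.1 (hDd θ')
      obtain ⟨φ, -, hφ⟩ := hcont u θ' hu
      have h1 : ∀ᵐ ω ∂P, ∀ k, 0 ≤ gains H (S (u (φ k))) T ω :=
        ae_all_iff.2 fun k => hpos _ (Set.mem_insert_of_mem θ (huD _))
      have h2 : ∀ᵐ ω ∂P, ∀ t ≤ T, Tendsto (fun k => S (u (φ k)) t ω) atTop (𝓝 (S θ' t ω)) :=
        ae_all_iff.2 fun t => ae_all_iff.2 (hφ t)
      filter_upwards [h1, h2] with ω h3 h4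
      exact ge_of_tendsto (tendsto_gains (Y := fun k => S (u (φ k))) h4)
        (Eventually.of_forall h3)
    exact fun θ' _ => hNRA H hH hall θ'
  open RobustMarket in
  have hunique : IsComplete P F T S → ∃ Z : DualSpace Θ P F T, IsRobustPricingSystem S Z ∧
      ∀ Z' : DualSpace Θ P F T, IsRobustPricingSystem S Z' → Z' = Z := by
    intro hcomp
    obtain ⟨θ, hθ⟩ := hne
    obtain ⟨Z, hZ, -⟩ := hex ⟨θ, hθ⟩ Set.univ MeasurableSet.univ (by simp)
    exact ⟨Z, hZ, fun Z' hZ' => hcomp.pricingSystem_unique hd hZ' hZ⟩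
  refine ⟨⟨fun hcomp => ?_, fun hcard => ?_⟩, fun hcomp => ?_, fun hcomp θ hNA => ?_⟩
  · obtain ⟨Z, hZ, huniq⟩ := hunique hcomp
    refine Set.encard_eq_one.2 ⟨Z, Set.eq_singleton_iff_unique_mem.2
      ⟨RobustMarket.mem_pricingSystems_iff.2 hZ, fun Z' hZ' => huniq Z' ?_⟩⟩
    exact RobustMarket.mem_pricingSystems_iff.1 hZ'
  · obtain ⟨Z, hZ⟩ := Set.encard_eq_one.1 hcard
    have hZmem := RobustMarket.mem_pricingSystems_iff.1 (hZ.symm ▸ Set.mem_singleton Z)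
    have huniq : ∀ Z' : RobustMarket.DualSpace Θ P F T,
        RobustMarket.IsRobustPricingSystem S Z' → Z' = Z := fun Z' hZ' => by
      have := RobustMarket.mem_pricingSystems_iff.2 hZ'
      rwa [hZ] at this
    have hpos := RobustMarket.density_pos_of_unique hex huniq
    exact RobustMarket.isComplete_of_unique hd hS hZmem huniq hpos
      fun θ => RobustMarket.mem_support_of_density_pos (hpos θ)
  · obtain ⟨Z, hZ, huniq⟩ := hunique hcomp
    have hpos := RobustMarket.density_pos_of_unique hex huniq
    -- Every model lies in the support of `Z`, which is finite.
    have : Finite Θ := Set.finite_univ_iff.1 (Z.support.finite_toSet.subset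
      fun θ _ => RobustMarket.mem_support_of_density_pos (hpos θ))
    exact Set.toFinite Θ
  · obtain ⟨Z, hZ, huniq⟩ := hunique hcomp
    have hpos := RobustMarket.density_pos_of_unique hex huniq
    refine Set.eq_singleton_iff_unique_mem.2 ⟨θ.2, fun θ' hθ' => ?_⟩
    exact congrArg Subtype.val (hcomp.eq_of_noArbitrage hd hZ hpos hNA ⟨θ', hθ'⟩)
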